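/- Let $\Lambda$ be a nonzero artin algebra and $\operatorname{mod}\Lambda$ the category of finitely generated right $\Lambda$-modules. Subcategories of $\operatorname{mod}\Lambda$ are full, additive, and closed under isomorphisms and direct summands; $\operatorname{add}\mathcal U$ denotes the class of direct summands of finite direct sums of modules in $\mathcal U$. *Extension dimension.* For classes $\mathcal U_1,\mathcal U_2$ of modules let $\mathcal U_1\bullet\mathcal U_2$ be $\operatorname{add}$ of the class of all $A$ for which there is an exact sequence $0\to U_1\to A\to U_2\to 0$ with $U_i\in\mathcal U_i$. For $A\in\operatorname{mod}\Lambda$ put $[A]_1=\operatorname{add}A$ and $[A]_n=[A]_1\bullet[A]_{n-1}$ for $n\ge 2$, and let $$\operatorname{extdim}\Lambda=\inf\{n\ge 0\mid \operatorname{mod}\Lambda=[A]_{n+1}\text{ for some }A\in\operatorname{mod}\Lambda\}$$ (with $\inf\varnothing=\infty$ here and below). *Relative dimensions.* A subcategory $\mathcal X$ of $\operatorname{mod}\Lambda$ is of finite type if it has only finitely many indecomposable modules up to isomorphism. It is resolving if it contains all projective modules of $\operatorname{mod}\Lambda$ and is closed under extensions and kernels of epimorphisms, and coresolving if it contains all injective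 modules of $\operatorname{mod}\Lambda$ and is closed under extensions and cokernels of monomorphisms. Let $\Omega^0_{\mathcal X}(M)=M$, let $\Omega^{n+1}_{\mathcal X}(M)$ be the kernel of a minimal right $\mathcal X$-approximation of $\Omega^n_{\mathcal X}(M)$, and let $\Omega^{-(n+1)}_{\mathcal X}(M)$ be the cokernel of a minimal left $\mathcal X$-approximation of $\Omega^{-n}_{\mathcal X}(M)$. For $M\neq 0$ put $\operatorname{pd}_{\mathcal X}M=\inf\{n\ge 0\mid\Omega^n_{\mathcal X}(M)\in\mathcal X\}$ and $\operatorname{id}_{\mathcal X}M=\inf\{n\ge 0\mid\Omega^{-n}_{\mathcal X}(M)\in\mathcal X\}$; for $M=0$ both are $-1$. For a class $\mathcal B$ of modules, $\operatorname{pd}_{\mathcal X}\mathcal B$ and $\operatorname{id}_{\mathcal X}\mathcal B$ are the suprema of these values over $M\in\mathcal B$, and are $-1$ if $\mathcal B=\varnothing$. *Layer length.* Let $\mathcal S$ be a complete set of pairwise non-isomorphic simple modules in $\operatorname{mod}\Lambda$ and $\mathcal V\subseteq\mathcal S$. Let $\mathfrak F(\mathcal V)$ be the class of modules having a finite filtration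 whose successive quotients are isomorphic to modules in $\mathcal V$, and let $\mathcal T_{\mathcal V}$ be the class of modules $M$ with $M/\operatorname{rad}M\in\operatorname{add}(\mathcal S\setminus\mathcal V)$. Then $(\mathcal T_{\mathcal V},\mathfrak F(\mathcal V))$ is a torsion pair; let $t_{\mathcal V}$ be its torsion radical, so that $t_{\mathcal V}(M)$ is the largest submodule of $M$ lying in $\mathcal T_{\mathcal V}$. With $F=\operatorname{rad}\circ\,t_{\mathcal V}$ put $$\ell\ell^{t_{\mathcal V}}(M)=\inf\{i\ge 0\mid t_{\mathcal V}(F^i(M))=0\}.$$ **Theorem 3.12.** Let $\mathcal V\subseteq\mathcal S$ and let $\mathcal X$ be a subcategory of $\operatorname{mod}\Lambda$ of finite type. 1. If $\mathcal X$ is resolving, then $\operatorname{extdim}\Lambda\le\operatorname{pd}_{\mathcal X}\mathcal V+\ell\ell^{t_{\mathcal V}}(\Lambda)$. 2. If $\mathcal X$ is coresolving, then $\operatorname{extdim}\Lambda\le\operatorname{id}_{\mathcal X}\mathcal V+\ell\ell^{t_{\mathcal V}}(\Lambda)$. Here $\Lambda$ is regarded as a right module over itself. -/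

import Mathlib

/-!
All modules over a ring `R` are left `R`-modules; right modules over `Λ` are modules over `Λᵐᵒᵖ`.
A (full) class of modules is a predicate on `ModuleCat R`, and `mod R` is the class of modules `M`
with `Module.Finite R M`. Dimensions take values in `EReal`, so that `-1` and `∞ = ⊤` are allowed
and the infimum of the empty set is `⊤`.
-/

universe u

namespace ExtDimension

variable {R : Type u} [Ring R]

/-! ### Additive closures, extensions and the extension dimension -/

/-- `add 𝓤`: direct summands of finite direct sums of modules in `𝓤`
(`M` is a direct summand of `N` if there are `i : M → N`, `r : N → M` with `r ∘ i = id`). -/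
def addClosure (U : ModuleCat.{u} R → Prop) (M : ModuleCat.{u} R) : Prop :=
  ∃ (n : ℕ) (X : Fin n → ModuleCat.{u} R), (∀ j, U (X j)) ∧
    ∃ (i : M →ₗ[R] (∀ j, X j)) (r : (∀ j, X j) →ₗ[R] M), r ∘ₗ i = LinearMap.id

/-- `0 → A → B → C → 0` is exact. -/
def IsShortExact {A B C : ModuleCat.{u} R} (f : A →ₗ[R] B) (g : B →ₗ[R] C) : Prop :=
  Function.Injective f ∧ Function.Exact f g ∧ Function.Surjective g

/-- `𝓤 • 𝓥 = add {A | there is an exact sequence 0 → U → A → V → 0, U ∈ 𝓤, V ∈ 𝓥}`. -/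
def bullet (U V : ModuleCat.{u} R → Prop) : ModuleCat.{u} R → Prop :=
  addClosure fun A => ∃ (B C : ModuleCat.{u} R) (f : B →ₗ[R] A) (g : A →ₗ[R] C),
    U B ∧ V C ∧ IsShortExact f g

/-- `[𝓤]₀ = 0`, `[𝓤]₁ = add 𝓤`, `[𝓤]ₙ = [𝓤]₁ • [𝓤]ₙ₋₁` for `n ≥ 2`. -/
def extPower (U : ModuleCat.{u} R → Prop) : ℕ → ModuleCat.{u} R → Prop
  | 0 => fun M => Subsingleton M
  | 1 => addClosure U
  | n + 2 => bullet (addClosure U) (extPower U (n + 1))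

/-- The class of modules isomorphic to `A`. -/
def isoClass (A : ModuleCat.{u} R) (M : ModuleCat.{u} R) : Prop := Nonempty (M ≃ₗ[R] A)

variable (R) in
/-- The extension dimension of `mod R`:
`inf {n ≥ 0 | mod R = [A]ₙ₊₁ for some A in mod R}`. -/
noncomputable def extDim : EReal :=
  ⨅ n ∈ {n : ℕ | ∃ A : ModuleCat.{u} R, Module.Finite R A ∧
    ∀ M : ModuleCat.{u} R, Module.Finite R M ↔ extPower (isoClass A) (n + 1) M}, ((n : ℝ) : EReal)

/-! ### Subcategories -/

/-- Subcategories of `mod R`: full, additive, closed under isomorphisms and direct summands. -/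
structure IsSubcategory (X : ModuleCat.{u} R → Prop) : Prop where
  finite : ∀ M, X M → Module.Finite R M
  zero : ∀ M : ModuleCat.{u} R, Subsingleton M → X M
  prod : ∀ M N, X M → X N → X (ModuleCat.of R (M × N))
  summand : ∀ (M N : ModuleCat.{u} R) (i : M →ₗ[R] N) (r : N →ₗ[R] M),
    r ∘ₗ i = LinearMap.id → X N → X M

/-- A module is indecomposable if it is nonzero and is not the direct sum of two nonzero
submodules. -/
def IsIndecomposable (M : ModuleCat.{u} R) : Prop :=
  Nontrivial M ∧ ∀ P Q : Submodule R M, IsCompl P Q → P = ⊥ ∨ Q = ⊥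

/-- `𝓧` has, up to isomorphism, only finitely many indecomposable modules. -/
def IsOfFiniteType (X : ModuleCat.{u} R → Prop) : Prop :=
  ∃ (n : ℕ) (Y : Fin n → ModuleCat.{u} R),
    ∀ M, X M → IsIndecomposable M → ∃ j, Nonempty (M ≃ₗ[R] Y j)

/-- Closed under extensions. -/
def ClosedUnderExtensions (X : ModuleCat.{u} R → Prop) : Prop :=
  ∀ (A B C : ModuleCat.{u} R) (f : A →ₗ[R] B) (g : B →ₗ[R] C),
    IsShortExact f g → X A → X C → X B

/-- Resolving: contains the projectives of `mod R`, closed under extensions and under kernels of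
epimorphisms. -/
structure IsResolving (X : ModuleCat.{u} R → Prop) : Prop where
  projective : ∀ M : ModuleCat.{u} R, Module.Finite R M → Module.Projective R M → X M
  ext : ClosedUnderExtensions X
  ker : ∀ (A B C : ModuleCat.{u} R) (f : A →ₗ[R] B) (g : B →ₗ[R] C),
    IsShortExact f g → X B → X C → X A

/-- Coresolving: contains the injectives of `mod R`, closed under extensions and under cokernels of
monomorphisms. -/
structure IsCoresolving (X : ModuleCat.{u} R → Prop) : Prop where
  injective : ∀ M : ModuleCat.{u} R, Module.Finite R M → Module.Injective R M → X M
  ext : ClosedUnderExtensions X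
  coker : ∀ (A B C : ModuleCat.{u} R) (f : A →ₗ[R] B) (g : B →ₗ[R] C),
    IsShortExact f g → X A → X B → X C

/-! ### Minimal approximations and relative dimensions -/

/-- `f : N → M` is a minimal right `𝓧`-approximation of `M`. -/
structure IsMinRightApprox (X : ModuleCat.{u} R → Prop) {N M : ModuleCat.{u} R}
    (f : N →ₗ[R] M) : Prop where
  mem : X N
  lift : ∀ (X' : ModuleCat.{u} R), X X' → ∀ g : X' →ₗ[R] M, ∃ h : X' →ₗ[R] N, f ∘ₗ h = g
  minimal : ∀ h : N →ₗ[R] N, f ∘ₗ h = f → Function.Bijective h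

/-- `f : M → N` is a minimal left `𝓧`-approximation of `M`. -/
structure IsMinLeftApprox (X : ModuleCat.{u} R → Prop) {M N : ModuleCat.{u} R}
    (f : M →ₗ[R] N) : Prop where
  mem : X N
  desc : ∀ (X' : ModuleCat.{u} R), X X' → ∀ g : M →ₗ[R] X', ∃ h : N →ₗ[R] X', h ∘ₗ f = g
  minimal : ∀ h : N →ₗ[R] N, h ∘ₗ f = f → Function.Bijective h

/-- `IsSyzygy X n M K`: the module `K` is (isomorphic to) `Ωⁿ_𝓧(M)`, where `Ω⁰_𝓧(M) = M` and
`Ωⁿ⁺¹_𝓧(M)` is the kernel of a minimal right `𝓧`-approximation of `Ωⁿ_𝓧(M)`. -/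
def IsSyzygy (X : ModuleCat.{u} R → Prop) : ℕ → ModuleCat.{u} R → ModuleCat.{u} R → Prop
  | 0, M, K => Nonempty (K ≃ₗ[R] M)
  | n + 1, M, K => ∃ L : ModuleCat.{u} R, IsSyzygy X n M L ∧
      ∃ (N : ModuleCat.{u} R) (f : N →ₗ[R] L),
        IsMinRightApprox X f ∧ Nonempty (K ≃ₗ[R] LinearMap.ker f)

/-- `IsCosyzygy X n M K`: the module `K` is (isomorphic to) `Ω⁻ⁿ_𝓧(M)`, where `Ω⁰_𝓧(M) = M` and
`Ω⁻⁽ⁿ⁺¹⁾_𝓧(M)` is the cokernel of a minimal left `𝓧`-approximation of `Ω⁻ⁿ_𝓧(M)`. -/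
def IsCosyzygy (X : ModuleCat.{u} R → Prop) : ℕ → ModuleCat.{u} R → ModuleCat.{u} R → Prop
  | 0, M, K => Nonempty (K ≃ₗ[R] M)
  | n + 1, M, K => ∃ L : ModuleCat.{u} R, IsCosyzygy X n M L ∧
      ∃ (N : ModuleCat.{u} R) (f : L →ₗ[R] N),
        IsMinLeftApprox X f ∧ Nonempty (K ≃ₗ[R] (N ⧸ LinearMap.range f))

open Classical in
/-- `pd_𝓧 M = inf {n | Ωⁿ_𝓧(M) ∈ 𝓧}` for `M ≠ 0`, and `pd_𝓧 0 = -1`. -/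
noncomputable def relPd (X : ModuleCat.{u} R → Prop) (M : ModuleCat.{u} R) : EReal :=
  if Subsingleton M then -1
  else ⨅ n ∈ {n : ℕ | ∃ K, IsSyzygy X n M K ∧ X K}, ((n : ℝ) : EReal)

open Classical in
/-- `id_𝓧 M = inf {n | Ω⁻ⁿ_𝓧(M) ∈ 𝓧}` for `M ≠ 0`, and `id_𝓧 0 = -1`. -/
noncomputable def relId (X : ModuleCat.{u} R → Prop) (M : ModuleCat.{u} R) : EReal :=
  if Subsingleton M then -1
  else ⨅ n ∈ {n : ℕ | ∃ K, IsCosyzygy X n M K ∧ X K}, ((n : ℝ) : EReal)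

open Classical in
/-- `pd_𝓧 𝓑 = sup {pd_𝓧 M | M ∈ 𝓑}` for `𝓑 ≠ ∅`, and `pd_𝓧 ∅ = -1`. -/
noncomputable def relPdClass (X : ModuleCat.{u} R → Prop) (B : Set (ModuleCat.{u} R)) : EReal :=
  if B = ∅ then -1 else ⨆ M ∈ B, relPd X M

open Classical in
/-- `id_𝓧 𝓑 = sup {id_𝓧 M | M ∈ 𝓑}` for `𝓑 ≠ ∅`, and `id_𝓧 ∅ = -1`. -/
noncomputable def relIdClass (X : ModuleCat.{u} R → Prop) (B : Set (ModuleCat.{u} R)) : EReal :=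
  if B = ∅ then -1 else ⨆ M ∈ B, relId X M

/-! ### Layer lengths and the torsion pair of a set of simple modules -/

/-- The `(α, β)`-layer length `inf {i ≥ 0 | α (βⁱ M) = 0}` (only the values of the functors
`α`, `β` on objects matter). -/
noncomputable def layerLength (α β : ModuleCat.{u} R → ModuleCat.{u} R) (M : ModuleCat.{u} R) :
    EReal :=
  ⨅ i ∈ {i : ℕ | Subsingleton (α (β^[i] M))}, ((i : ℝ) : EReal)

/-- The Jacobson radical of a module. -/
noncomputable abbrev radical (M : ModuleCat.{u} R) : ModuleCat.{u} R :=
  ModuleCat.of R (Module.jacobson R M)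

/-- The top `M / rad M`. -/
noncomputable abbrev top (M : ModuleCat.{u} R) : ModuleCat.{u} R :=
  ModuleCat.of R (M ⧸ Module.jacobson R M)

/-- The `α`-radical layer length `ℓℓ^α`: the `(α, F_α)`-layer length with `F_α = rad ∘ α`. -/
noncomputable def radicalLayerLength (α : ModuleCat.{u} R → ModuleCat.{u} R)
    (M : ModuleCat.{u} R) : EReal :=
  layerLength α (fun N => radical (α N)) M

/-- The simple modules that are not isomorphic to a member of `𝓥`. -/
def simpleCompl (V : Set (ModuleCat.{u} R)) (S : ModuleCat.{u} R) : Prop :=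
  IsSimpleModule R S ∧ ∀ S' ∈ V, IsEmpty (S ≃ₗ[R] S')

/-- The torsion class `𝓣_𝓥`: the `M` in `mod R` with `top M ∈ add 𝓥'`, where `𝓥'` consists of the
simple modules outside `𝓥`. -/
def torsionClass (V : Set (ModuleCat.{u} R)) (M : ModuleCat.{u} R) : Prop :=
  Module.Finite R M ∧ addClosure (simpleCompl V) (top M)

/-- The torsion-free class `𝔉(𝓥)`: the `M` in `mod R` with a finite chain
`0 = M₀ ⊆ M₁ ⊆ ⋯ ⊆ Mₘ = M` of submodules whose successive quotients are isomorphic to modules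
in `𝓥`. -/
def filtClass (V : Set (ModuleCat.{u} R)) (M : ModuleCat.{u} R) : Prop :=
  Module.Finite R M ∧ ∃ (m : ℕ) (c : ℕ → Submodule R M), c 0 = ⊥ ∧ c m = ⊤ ∧
    ∀ i < m, c i ≤ c (i + 1) ∧
      ∃ S ∈ V, Nonempty ((c (i + 1) ⧸ (c i).submoduleOf (c (i + 1))) ≃ₗ[R] S)

/-- The largest torsion submodule of `M`, i.e. the sum of all submodules of `M` lying in `𝓣_𝓥`. -/
def torsionSubmodule (V : Set (ModuleCat.{u} R)) (M : ModuleCat.{u} R) : Submodule R M :=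
  sSup {N : Submodule R M | torsionClass V (ModuleCat.of R N)}

/-- The torsion radical `t_𝓥` of the torsion pair `(𝓣_𝓥, 𝔉(𝓥))`. -/
noncomputable abbrev torsionRadical (V : Set (ModuleCat.{u} R)) (M : ModuleCat.{u} R) :
    ModuleCat.{u} R :=
  ModuleCat.of R (torsionSubmodule V M)

/-! The submodule `t_𝓥(M)` really is the torsion part of `M`: `t_𝓥(M) ∈ 𝓣_𝓥`, `M / t_𝓥(M) ∈ 𝔉(𝓥)`. -/

/-- `M ∈ 𝓣_𝓥` iff there is no nonzero map from `M` to a module in `𝓥`. -/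
theorem torsionClass_iff [IsArtinianRing R] {V : Set (ModuleCat.{u} R)}
    (hV : ∀ S ∈ V, IsSimpleModule R S) (M : ModuleCat.{u} R) :
    torsionClass V M ↔ Module.Finite R M ∧ ∀ S ∈ V, ∀ f : M →ₗ[R] S, f = 0 := by
  classical
  refine and_congr_right fun hM => ⟨?_, fun h => ?_⟩
  · rintro ⟨n, X, hX, i, r, hir⟩ S hS f
    have := hV S hS
    let g : (M ⧸ Module.jacobson R M) →ₗ[R] S :=
      (Module.jacobson R M).liftQ f (IsSemisimpleModule.jacobson_le_ker R R M S f)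
    have hgr : g ∘ₗ r = 0 := by
      refine LinearMap.pi_ext' fun j => ?_
      have := (hX j).1
      rcases LinearMap.bijective_or_eq_zero ((g ∘ₗ r) ∘ₗ LinearMap.single R (fun j => X j) j)
        with hb | h0
      · exact ((hX j).2 S hS).elim (LinearEquiv.ofBijective _ hb)
      · simpa using h0
    have hg : g = 0 := by
      refine LinearMap.ext fun x => ?_
      have h1 : r (i x) = x := LinearMap.congr_fun hir x
      have h2 : g (r (i x)) = 0 := LinearMap.congr_fun hgr (i x)
      rwa [h1] at h2
    ext x
    exact LinearMap.congr_fun hg (Submodule.Quotient.mk x)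
  · have hs : IsSemisimpleModule R (M ⧸ Module.jacobson R M) :=
      (IsArtinian.isSemisimpleModule_iff_jacobson R _).2 (Module.jacobson_quotient_jacobson R M)
    obtain ⟨n, S, e, hS⟩ :=
      IsSemisimpleModule.exists_linearEquiv_fin_dfinsupp R (M ⧸ Module.jacobson R M)
    let e' : (M ⧸ Module.jacobson R M) ≃ₗ[R] (∀ j, S j) :=
      e.trans (DirectSum.linearEquivFunOnFintype R (Fin n) (fun j => S j))
    refine ⟨n, fun j => ModuleCat.of R (S j), fun j => ⟨hS j, fun S' hS' => ⟨fun φ => ?_⟩⟩,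
      e'.toLinearMap, e'.symm.toLinearMap, by ext x; exact e'.symm_apply_apply _⟩
    have h0 := h S' hS' (φ.toLinearMap ∘ₗ LinearMap.proj j ∘ₗ e'.toLinearMap ∘ₗ
      (Module.jacobson R M).mkQ)
    have hsurj : Function.Surjective (φ.toLinearMap ∘ₗ LinearMap.proj j ∘ₗ e'.toLinearMap ∘ₗ
      (Module.jacobson R M).mkQ) :=
      φ.surjective.comp ((Function.surjective_eval j).comp (e'.surjective.comp
        (Submodule.mkQ_surjective _)))
    have := (hV S' hS').nontrivial
    obtain ⟨y, hy⟩ := exists_ne (0 : S')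
    obtain ⟨x, rfl⟩ := hsurj y
    exact hy (LinearMap.congr_fun h0 x)

/-- `t_𝓥(M) ∈ 𝓣_𝓥`. -/
theorem torsionRadical_mem [IsArtinianRing R] {V : Set (ModuleCat.{u} R)}
    (hV : ∀ S ∈ V, IsSimpleModule R S) (M : ModuleCat.{u} R) [Module.Finite R M] :
    torsionClass V (torsionRadical V M) := by
  refine (torsionClass_iff hV _).2 ⟨inferInstanceAs (Module.Finite R (torsionSubmodule V M)),
    fun S hS f => ?_⟩
  change (torsionSubmodule V M) →ₗ[R] S at f
  have key : torsionSubmodule V M ≤ (LinearMap.ker f).map (torsionSubmodule V M).subtype := by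
    refine sSup_le fun N hN x hx => ?_
    have hle : N ≤ torsionSubmodule V M := le_sSup hN
    refine ⟨⟨x, hle hx⟩, ?_, rfl⟩
    have := ((torsionClass_iff hV _).1 hN).2 S hS (f ∘ₗ Submodule.inclusion hle)
    exact LinearMap.congr_fun this ⟨x, hx⟩
  refine LinearMap.ext fun x => ?_
  change (torsionSubmodule V M) at x
  obtain ⟨y, hy, hyx⟩ := key x.2
  have : y = x := Subtype.ext hyx
  exact this ▸ hy

theorem filtClass_of [IsArtinianRing R] {V : Set (ModuleCat.{u} R)}
    (hV : ∀ S ∈ V, IsSimpleModule R S) (Q : ModuleCat.{u} R) [Module.Finite R Q]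
    (h : ∀ N : Submodule R Q, torsionClass V (ModuleCat.of R N) → N = ⊥) : filtClass V Q := by
  refine ⟨inferInstance, ?_⟩
  suffices ∀ N : Submodule R Q, ∃ (m : ℕ) (c : ℕ → Submodule R Q), c 0 = ⊥ ∧ c m = N ∧
    ∀ i < m, c i ≤ c (i + 1) ∧
      ∃ S ∈ V, Nonempty ((c (i + 1) ⧸ (c i).submoduleOf (c (i + 1))) ≃ₗ[R] S) from this ⊤
  intro N
  induction N using WellFoundedLT.induction with
  | ind N ih =>
    by_cases hN : N = ⊥
    · exact ⟨0, fun _ => ⊥, rfl, hN.symm, by simp⟩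
    have hT : ¬ torsionClass V (ModuleCat.of R N) := fun hh => hN (h N hh)
    rw [torsionClass_iff hV] at hT
    push Not at hT
    obtain ⟨S, hS, f, hf⟩ := hT (inferInstanceAs (Module.Finite R N))
    change N →ₗ[R] S at f
    have := hV S hS
    have hsurj : Function.Surjective f := LinearMap.surjective_of_ne_zero hf
    set K := (LinearMap.ker f).map N.subtype with hK
    have hKN : K ≤ N := Submodule.map_subtype_le _ _
    have hKo : K.submoduleOf N = LinearMap.ker f := by
      rw [hK, Submodule.submoduleOf, Submodule.comap_map_eq_of_injective N.injective_subtype]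
    have hlt : K < N := by
      refine lt_of_le_of_ne hKN fun hh => hf ?_
      rw [hh, Submodule.submoduleOf_self] at hKo
      exact LinearMap.ker_eq_top.1 hKo.symm
    obtain ⟨m, c, h0, hm, hc⟩ := ih K hlt
    refine ⟨m + 1, fun i => if i ≤ m then c i else N, by simpa using h0, by simp, fun i hi => ?_⟩
    by_cases him : i < m
    · have h1 : i ≤ m := him.le
      have h2 : i + 1 ≤ m := him
      have e1 : (if i ≤ m then c i else N) = c i := if_pos h1
      have e2 : (if i + 1 ≤ m then c (i + 1) else N) = c (i + 1) := if_pos h2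
      beta_reduce
      rw [e1, e2]
      exact hc i him
    · obtain rfl : i = m := by omega
      have h2 : ¬ i + 1 ≤ i := by omega
      have e1 : (if i ≤ i then c i else N) = K := (if_pos le_rfl).trans hm
      have e2 : (if i + 1 ≤ i then c (i + 1) else N) = N := if_neg h2
      beta_reduce
      rw [e1, e2]
      exact ⟨hKN, S, hS, ⟨(Submodule.quotEquivOfEq _ _ hKo).trans
        (f.quotKerEquivOfSurjective hsurj)⟩⟩

/-- `M / t_𝓥(M) ∈ 𝔉(𝓥)`. -/
theorem quotient_mem_filtClass [IsArtinianRing R] {V : Set (ModuleCat.{u} R)}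
    (hV : ∀ S ∈ V, IsSimpleModule R S) (M : ModuleCat.{u} R) [Module.Finite R M] :
    filtClass V (ModuleCat.of R (M ⧸ torsionSubmodule V M)) := by
  let t := torsionSubmodule V M
  refine filtClass_of hV (ModuleCat.of R (M ⧸ t)) fun (N : Submodule R (M ⧸ t)) hN => ?_
  have hle : t ≤ N.comap t.mkQ := by
    intro x hx
    have : t.mkQ x = 0 := by simpa using hx
    rw [Submodule.mem_comap, this]; exact N.zero_mem
  have : torsionClass V (ModuleCat.of R (N.comap t.mkQ)) := by
    refine (torsionClass_iff hV _).2
      ⟨inferInstanceAs (Module.Finite R (N.comap t.mkQ)), fun S hS f => ?_⟩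
    change (N.comap t.mkQ) →ₗ[R] S at f
    have h1 := ((torsionClass_iff hV _).1 (torsionRadical_mem hV M)).2 S hS (f ∘ₗ Submodule.inclusion hle)
    let π : (N.comap t.mkQ) →ₗ[R] N := t.mkQ.restrict (fun x hx => hx)
    have hπ : Function.Surjective π := by
      rintro ⟨y, hy⟩
      obtain ⟨x, rfl⟩ := t.mkQ_surjective y
      exact ⟨⟨x, hy⟩, rfl⟩
    have hker : LinearMap.ker π ≤ LinearMap.ker f := by
      rintro ⟨x, hx⟩ hxx
      have hxt : x ∈ t := by
        have := congrArg Subtype.val hxx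
        simpa [π] using this
      exact LinearMap.congr_fun h1 ⟨x, hxt⟩
    let g : N →ₗ[R] S := (LinearMap.ker π).liftQ f hker ∘ₗ
      (π.quotKerEquivOfSurjective hπ).symm.toLinearMap
    have hg : g = 0 := ((torsionClass_iff hV _).1 hN).2 S hS g
    refine LinearMap.ext fun x => ?_
    have := LinearMap.congr_fun hg (π x)
    have e : (π.quotKerEquivOfSurjective hπ).symm (π x) = Submodule.Quotient.mk x :=
      (LinearEquiv.symm_apply_eq _).2 rfl
    change (LinearMap.ker π).liftQ f hker ((π.quotKerEquivOfSurjective hπ).symm (π x)) = 0 at this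
    rwa [e] at this
  have h2 : N.comap t.mkQ ≤ t := le_sSup this
  refine eq_bot_iff.2 fun y hy => ?_
  obtain ⟨x, rfl⟩ := t.mkQ_surjective y
  have : x ∈ t := h2 hy
  simpa using this

end ExtDimension

/-! Let `R` be the opposite ring of Λ, let i be the layer length of the regular module and p = pd_𝓧
𝓥, both finite, with 𝓥 nonempty. Finite type means that 𝓧 = add A₀ for a single module A₀.

Layers. Every finitely generated M is a quotient of a power of the regular module, and a surjection
Mⁿ → N induces surjections t(M)ⁿ → t(N) and rad(M)ⁿ → rad(N). Hence the chain M ⊇ t(M) ⊇ rad t(M) ⊇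
... reaches a module of 𝔉(𝓥) after i rounds for every M, not only for the regular one. Its factors
are i + 1 modules of 𝔉(𝓥) interleaved with i modules of add(R/rad R) (`layered_of_subsingleton`).

Resolving all layers at once. By Wakamatsu's lemma the kernel K of a minimal right 𝓧-approximation
satisfies Ext¹(𝓧, K) = 0. Such covers of the two ends of an exact sequence combine into a cover of
the middle: the obstruction lies in Ext²(N₂, K₁) = Ext¹(ΩN₂, K₁), which vanishes because ΩN₂ is in 𝓧
(`RTrans.star`). Thus modules of 𝔉(𝓥) have such 𝓧-resolutions of length p, and after p + 1 steps the
𝔉(𝓥)-layers of M have become zero. What remains is an i-fold extension of modules in add B', where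
B' is a relative syzygy of R/rad R and does not depend on M.

Going back. Each step 0 → K → N → M → 0 costs one extension. If K, up to an injective summand, is a
q-fold extension of modules in add A, embed it in an injective I' with cokernel C, which is again a
q-fold extension of injective cosyzygies. The pushout of N and I' over K is an extension of M by I',
so it is M ⊕ I', and also an extension of C by N (`exists_starPow_of_kernel`). After p + 1 steps M
is a summand of an (i + p + 1)-fold extension, which gives extdim ≤ p + i.

The coresolving case is dual, with free covers in place of injective envelopes on the way back. For
𝓥 = ∅ the 𝔉(𝓥)-layers vanish from the start, so M is itself an i-fold extension and the bound is i -
1. The artin algebra hypothesis supplies minimal approximations (`homFinite`) and a finitely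
generated injective cogenerator (`exists_isInjectiveCogenerator`). -/

namespace ExtDimension

variable {R : Type u} [Ring R]

/-! ### Short exact sequences, pushouts and pullbacks -/

theorem exists_factor_of_injective {A B C : ModuleCat.{u} R} {f : A →ₗ[R] B}
    (hf : Function.Injective f) (h : C →ₗ[R] B) (H : ∀ c, ∃ a, f a = h c) :
    ∃ t : C →ₗ[R] A, ∀ c, f (t c) = h c := by
  choose t ht using H
  exact ⟨{ toFun := t
           map_add' := fun x y => hf (by simp [ht])
           map_smul' := fun x y => hf (by simp [ht]) }, ht⟩

theorem exists_factor_of_surjective {A B C : ModuleCat.{u} R} {g : A →ₗ[R] B}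
    (hg : Function.Surjective g) (h : A →ₗ[R] C) (H : ∀ a, g a = 0 → h a = 0) :
    ∃ t : B →ₗ[R] C, ∀ a, t (g a) = h a := by
  choose s hs using hg
  have key : ∀ a b, g a = g b → h a = h b := fun a b hab =>
    sub_eq_zero.1 (by rw [← map_sub]; exact H _ (by rw [map_sub, hab, sub_self]))
  exact ⟨{ toFun := fun b => h (s b)
           map_add' := fun x y => by rw [← map_add]; exact key _ _ (by simp [hs])
           map_smul' := fun r x => by
            rw [RingHom.id_apply, ← map_smul]; exact key _ _ (by simp [hs]) },
    fun a => key _ _ (hs _)⟩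

namespace IsShortExact

variable {A B C : ModuleCat.{u} R} {f : A →ₗ[R] B} {g : B →ₗ[R] C}

theorem zero (h : IsShortExact f g) (a : A) : g (f a) = 0 := h.2.1.apply_apply_eq_zero a

theorem exact (h : IsShortExact f g) {b : B} (hb : g b = 0) : ∃ a, f a = b := (h.2.1 b).1 hb

theorem lift (h : IsShortExact f g) {T : ModuleCat.{u} R} (t : T →ₗ[R] B)
    (ht : ∀ x, g (t x) = 0) : ∃ s : T →ₗ[R] A, ∀ x, f (s x) = t x :=
  exists_factor_of_injective h.1 t fun x => h.exact (ht x)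

theorem desc (h : IsShortExact f g) {T : ModuleCat.{u} R} (t : B →ₗ[R] T)
    (ht : ∀ x, t (f x) = 0) : ∃ s : C →ₗ[R] T, ∀ x, s (g x) = t x :=
  exists_factor_of_surjective h.2.2 t fun x hx => by
    obtain ⟨a, rfl⟩ := h.exact hx
    exact ht a

theorem mk' (hf : Function.Injective f) (h0 : ∀ a, g (f a) = 0)
    (he : ∀ b, g b = 0 → ∃ a, f a = b) (hg : Function.Surjective g) : IsShortExact f g :=
  ⟨hf, fun b => ⟨he b, by rintro ⟨a, rfl⟩; exact h0 a⟩, hg⟩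

theorem exists_section (h : IsShortExact f g) {r : B →ₗ[R] A} (hr : ∀ a, r (f a) = a) :
    ∃ s : C →ₗ[R] B, ∀ c, g (s c) = c := by
  obtain ⟨s, hs⟩ := h.desc (LinearMap.id - f ∘ₗ r) (fun x => by simp [hr])
  refine ⟨s, fun c => ?_⟩
  obtain ⟨b, rfl⟩ := h.2.2 c
  simp [hs, h.zero]

theorem exists_retraction (h : IsShortExact f g) {s : C →ₗ[R] B} (hs : ∀ c, g (s c) = c) :
    ∃ r : B →ₗ[R] A, ∀ a, r (f a) = a := by
  obtain ⟨r, hr⟩ := h.lift (LinearMap.id - s ∘ₗ g) (fun x => by simp [hs])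
  refine ⟨r, fun a => h.1 ?_⟩
  simp [hr, h.zero]

theorem nonempty_equiv_prod (h : IsShortExact f g) {s : C →ₗ[R] B} (hs : ∀ c, g (s c) = c) :
    Nonempty (B ≃ₗ[R] A × C) := by
  obtain ⟨r, hr⟩ := h.lift (LinearMap.id - s ∘ₗ g) (fun x => by simp [hs])
  refine ⟨LinearEquiv.ofLinearMap (r.prod g) (f.coprod s) ?_ ?_⟩
  · refine LinearMap.ext fun x => Prod.ext (h.1 ?_) ?_
    · simp [hr, h.zero, hs]
    · simp [h.zero, hs]
  · refine LinearMap.ext fun x => ?_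
    simp [hr]

theorem of_surjective (hg : Function.Surjective g) :
    IsShortExact (A := ModuleCat.of R (LinearMap.ker g)) (LinearMap.ker g).subtype g :=
  mk' Subtype.val_injective (fun a => a.2) (fun b hb => ⟨⟨b, hb⟩, rfl⟩) hg

theorem of_injective (hf : Function.Injective f) :
    IsShortExact (C := ModuleCat.of R (B ⧸ LinearMap.range f)) f (LinearMap.range f).mkQ :=
  mk' hf (fun a => by simp) (fun b hb => by simpa using hb) (Submodule.mkQ_surjective _)

theorem equiv_left (h : IsShortExact f g) {A' : ModuleCat.{u} R} (e : A' ≃ₗ[R] A) :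
    IsShortExact (f ∘ₗ e.toLinearMap) g :=
  mk' (h.1.comp e.injective) (fun a => h.zero _)
    (fun b hb => let ⟨a, ha⟩ := h.exact hb; ⟨e.symm a, by simpa using ha⟩) h.2.2

theorem equiv_middle (h : IsShortExact f g) {B' : ModuleCat.{u} R} (e : B ≃ₗ[R] B') :
    IsShortExact (e.toLinearMap ∘ₗ f) (g ∘ₗ e.symm.toLinearMap) :=
  mk' (e.injective.comp h.1) (fun a => by simp [h.zero])
    (fun b hb => let ⟨a, ha⟩ := h.exact hb; ⟨a, by simp [ha]⟩) (h.2.2.comp e.symm.surjective)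

theorem equiv_right (h : IsShortExact f g) {C' : ModuleCat.{u} R} (e : C ≃ₗ[R] C') :
    IsShortExact f (e.toLinearMap ∘ₗ g) :=
  mk' h.1 (fun a => by simp [h.zero]) (fun b hb => h.exact (by simpa using hb))
    (e.surjective.comp h.2.2)

theorem bijective_right [Subsingleton A] (h : IsShortExact f g) : Function.Bijective g :=
  ⟨(injective_iff_map_eq_zero _).2 fun b hb => by
    obtain ⟨a, rfl⟩ := h.exact hb
    rw [Subsingleton.elim a 0, map_zero], h.2.2⟩

theorem bijective_left [Subsingleton C] (h : IsShortExact f g) : Function.Bijective f :=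
  ⟨h.1, fun _ => h.exact (Subsingleton.elim _ _)⟩

theorem id_left (A : ModuleCat.{u} R) (Z : ModuleCat.{u} R) [Subsingleton Z] :
    IsShortExact (0 : Z →ₗ[R] A) (LinearMap.id : A →ₗ[R] A) :=
  mk' (Function.injective_of_subsingleton _) (fun a => by simp)
    (fun _ hb => ⟨0, by simpa using hb.symm⟩) Function.surjective_id

theorem id_right (A : ModuleCat.{u} R) (Z : ModuleCat.{u} R) [Subsingleton Z] :
    IsShortExact (LinearMap.id : A →ₗ[R] A) (0 : A →ₗ[R] Z) :=
  mk' Function.injective_id (fun a => by simp)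
    (fun b _ => ⟨b, rfl⟩) (Function.surjective_to_subsingleton _)

theorem compLeft (h : IsShortExact f g) (n : ℕ) :
    IsShortExact (A := ModuleCat.of R (Fin n → A)) (B := ModuleCat.of R (Fin n → B))
      (C := ModuleCat.of R (Fin n → C)) (f.compLeft (Fin n)) (g.compLeft (Fin n)) :=
  mk' (h.1.comp_left) (fun a => funext fun j => h.zero _)
    (fun b hb => by
      choose a ha using fun j => h.exact (congrFun hb j)
      exact ⟨a, funext ha⟩)
    (h.2.2.comp_left)

theorem finite_middle (h : IsShortExact f g) (hA : Module.Finite R A) (hC : Module.Finite R C) :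
    Module.Finite R B := by
  have : Module.Finite R (LinearMap.ker g) := by
    refine Module.Finite.of_surjective
      (f.codRestrict (LinearMap.ker g) (fun a => h.zero a)) ?_
    rintro ⟨b, hb⟩
    obtain ⟨a, rfl⟩ := h.exact hb
    exact ⟨a, rfl⟩
  have : Module.Finite R (B ⧸ LinearMap.ker g) :=
    Module.Finite.equiv (g.quotKerEquivOfSurjective h.2.2).symm
  exact Module.Finite.of_submodule_quotient (LinearMap.ker g)

theorem finite_right (h : IsShortExact f g) (hB : Module.Finite R B) : Module.Finite R C :=
  Module.Finite.of_surjective g h.2.2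

theorem finite_left [IsNoetherianRing R] (h : IsShortExact f g) (hB : Module.Finite R B) :
    Module.Finite R A :=
  Module.Finite.of_injective f h.1

/-- Pushout of a short exact sequence along a map from its left term. -/
theorem exists_pushout (h : IsShortExact f g) {D : ModuleCat.{u} R} (v : A →ₗ[R] D) :
    ∃ (E : ModuleCat.{u} R) (i : D →ₗ[R] E) (j : B →ₗ[R] E) (q : E →ₗ[R] C),
      IsShortExact i q ∧ (∀ a, i (v a) = j (f a)) ∧ (∀ b, q (j b) = g b) ∧
      (∀ e, ∃ d b, e = i d + j b) ∧ (∀ d b, i d = j b → ∃ a, v a = d ∧ f a = b) ∧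
      ∀ (T : ModuleCat.{u} R) (x : D →ₗ[R] T) (y : B →ₗ[R] T), (∀ a, x (v a) = y (f a)) →
        ∃ t : E →ₗ[R] T, (∀ d, t (i d) = x d) ∧ ∀ b, t (j b) = y b := by
  let N : Submodule R (D × B) := LinearMap.range (v.prod (-f))
  let i : D →ₗ[R] ((D × B) ⧸ N) := N.mkQ ∘ₗ LinearMap.inl R D B
  let j : B →ₗ[R] ((D × B) ⧸ N) := N.mkQ ∘ₗ LinearMap.inr R D B
  have hij : ∀ a, i (v a) = j (f a) := fun a => by
    refine (Submodule.Quotient.eq N).2 ⟨a, ?_⟩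
    simp
  have hs : ∀ e, ∃ d b, e = i d + j b := by
    intro e
    obtain ⟨⟨d, b⟩, rfl⟩ := N.mkQ_surjective e
    refine ⟨d, b, ?_⟩
    simp only [i, j, LinearMap.comp_apply, ← map_add]
    simp
  have hk : ∀ d b, i d = j b → ∃ a, v a = d ∧ f a = b := by
    intro d b hdb
    obtain ⟨a, ha⟩ := (Submodule.Quotient.eq N).1 hdb
    refine ⟨a, ?_, ?_⟩
    · simpa using congrArg Prod.fst ha
    · simpa using congrArg Prod.snd ha
  have hd : ∀ (T : ModuleCat.{u} R) (x : D →ₗ[R] T) (y : B →ₗ[R] T), (∀ a, x (v a) = y (f a)) →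
        ∃ t : ((D × B) ⧸ N) →ₗ[R] T, (∀ d, t (i d) = x d) ∧ ∀ b, t (j b) = y b := by
    intro T x y hxy
    refine ⟨N.liftQ (x.coprod y) ?_, fun d => ?_, fun b => ?_⟩
    · rintro _ ⟨a, rfl⟩
      simp [hxy]
    · simp [i]
    · simp [j]
  obtain ⟨q, hq1, hq2⟩ := hd C 0 g (fun a => by simp [h.zero])
  refine ⟨ModuleCat.of R ((D × B) ⧸ N), i, j, q, mk' ?_ (by simpa using hq1) ?_ ?_, hij, hq2, hs,
    hk, hd⟩
  · refine (injective_iff_map_eq_zero _).2 fun d hd => ?_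
    obtain ⟨a, rfl, ha⟩ := hk d 0 (by simpa using hd)
    rw [h.1 (ha.trans (map_zero f).symm), map_zero]
  · intro e he
    obtain ⟨d, b, rfl⟩ := hs e
    rw [map_add, hq1, hq2, LinearMap.zero_apply, zero_add] at he
    obtain ⟨a, rfl⟩ := h.exact he
    exact ⟨d + v a, by rw [map_add, hij]⟩
  · intro c
    obtain ⟨b, rfl⟩ := h.2.2 c
    exact ⟨j b, hq2 b⟩

/-- Pullback of a short exact sequence along a map to its right term. -/
theorem exists_pullback (h : IsShortExact f g) {D : ModuleCat.{u} R} (w : D →ₗ[R] C) :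
    ∃ (E : ModuleCat.{u} R) (i : A →ₗ[R] E) (p : E →ₗ[R] B) (q : E →ₗ[R] D),
      IsShortExact i q ∧ (∀ e, g (p e) = w (q e)) ∧ (∀ a, p (i a) = f a) ∧
      (∀ e, p e = 0 → q e = 0 → e = 0) ∧ (∀ b d, g b = w d → ∃ e, p e = b ∧ q e = d) ∧
      ∀ (T : ModuleCat.{u} R) (x : T →ₗ[R] B) (y : T →ₗ[R] D), (∀ a, g (x a) = w (y a)) →
        ∃ t : T →ₗ[R] E, (∀ a, p (t a) = x a) ∧ ∀ a, q (t a) = y a := by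
  let N : Submodule R (B × D) := LinearMap.ker (g ∘ₗ LinearMap.fst R B D - w ∘ₗ LinearMap.snd R B D)
  have hN : ∀ b d, (b, d) ∈ N ↔ g b = w d := fun b d => by
    simp [N, sub_eq_zero]
  let p : N →ₗ[R] B := LinearMap.fst R B D ∘ₗ N.subtype
  let q : N →ₗ[R] D := LinearMap.snd R B D ∘ₗ N.subtype
  have hd : ∀ (T : ModuleCat.{u} R) (x : T →ₗ[R] B) (y : T →ₗ[R] D), (∀ a, g (x a) = w (y a)) →
        ∃ t : T →ₗ[R] N, (∀ a, p (t a) = x a) ∧ ∀ a, q (t a) = y a := fun T x y hxy =>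
    ⟨(x.prod y).codRestrict N fun a => (hN _ _).2 (hxy a), fun a => rfl, fun a => rfl⟩
  obtain ⟨i, hi1, hi2⟩ := hd A f 0 (fun a => by simp [h.zero])
  refine ⟨ModuleCat.of R N, i, p, q, mk' ?_ (by simpa using hi2) ?_ ?_, ?_, hi1, ?_, ?_, hd⟩
  · exact fun a b hab => h.1 (by rw [← hi1, ← hi1, hab])
  · rintro ⟨⟨b, d⟩, hbd⟩ (rfl : d = 0)
    obtain ⟨a, rfl⟩ := h.exact (((hN _ _).1 hbd).trans (map_zero w))
    exact ⟨a, Subtype.ext (Prod.ext (hi1 a) (hi2 a))⟩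
  · intro d
    obtain ⟨b, hb⟩ := h.2.2 (w d)
    exact ⟨⟨(b, d), (hN _ _).2 hb⟩, rfl⟩
  · exact fun e => (hN _ _).1 e.2
  · exact fun e h1 h2 => Subtype.ext (Prod.ext h1 h2)
  · exact fun b d hbd => ⟨⟨(b, d), (hN _ _).2 hbd⟩, rfl, rfl⟩

/-! ### Snake lemma for maps of short exact sequences. -/

variable {K₁ K₂ N₁ N N₂ : ModuleCat.{u} R}

/-- The kernels of a surjective map of short exact sequences form a short exact sequence. -/
theorem exists_kernels {s : N₁ →ₗ[R] N} {t : N →ₗ[R] N₂} {i₁ : K₁ →ₗ[R] N₁} {x₁ : N₁ →ₗ[R] A}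
    {i₂ : K₂ →ₗ[R] N₂} {x₂ : N₂ →ₗ[R] C} (h : IsShortExact f g) (hN : IsShortExact s t)
    (h₁ : IsShortExact i₁ x₁) (h₂ : IsShortExact i₂ x₂) (x : N →ₗ[R] B)
    (hs : ∀ a, x (s a) = f (x₁ a)) (ht : ∀ b, g (x b) = x₂ (t b)) :
    ∃ (K : ModuleCat.{u} R) (i : K →ₗ[R] N) (a : K₁ →ₗ[R] K) (b : K →ₗ[R] K₂),
      IsShortExact i x ∧ IsShortExact a b := by
  have hx : Function.Surjective x := by
    intro b
    obtain ⟨n₂, hn₂⟩ := h₂.2.2 (g b)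
    obtain ⟨n, rfl⟩ := hN.2.2 n₂
    obtain ⟨a, ha⟩ := h.exact (b := b - x n) (by rw [map_sub, ht, hn₂, sub_self])
    obtain ⟨n₁, rfl⟩ := h₁.2.2 a
    exact ⟨s n₁ + n, by rw [map_add, hs, ha, sub_add_cancel]⟩
  have hi := of_surjective hx
  set i : ModuleCat.of R (LinearMap.ker x) →ₗ[R] N := (LinearMap.ker x).subtype
  obtain ⟨a, ha⟩ := hi.lift (s ∘ₗ i₁) (fun k => by simp [hs, h₁.zero])
  obtain ⟨b, hb⟩ := h₂.lift (t ∘ₗ i) (fun k => by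
    rw [LinearMap.comp_apply, ← ht, hi.zero, map_zero])
  refine ⟨_, i, a, b, hi, mk' ?_ ?_ ?_ ?_⟩
  · intro y z hyz
    refine h₁.1 (hN.1 ?_)
    exact (ha y).symm.trans ((congrArg i hyz).trans (ha z))
  · intro k
    refine h₂.1 ?_
    rw [hb, LinearMap.comp_apply, ha, LinearMap.comp_apply, hN.zero, map_zero]
  · intro k hk
    obtain ⟨n₁, hn₁⟩ := hN.exact (b := i k) (by
      rw [← LinearMap.comp_apply, ← hb, hk, map_zero])
    obtain ⟨k₁, rfl⟩ := h₁.exact (b := n₁) (h.1 (by rw [← hs, hn₁, hi.zero, map_zero]))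
    exact ⟨k₁, hi.1 (by rw [ha, LinearMap.comp_apply, hn₁])⟩
  · intro k₂
    obtain ⟨n, hn⟩ := hN.2.2 (i₂ k₂)
    obtain ⟨c, hc⟩ := h.exact (b := x n) (by rw [ht, hn, h₂.zero])
    obtain ⟨n₁, rfl⟩ := h₁.2.2 c
    obtain ⟨k, hk⟩ := hi.exact (b := n - s n₁) (by rw [map_sub, hs, hc, sub_self])
    refine ⟨k, h₂.1 ?_⟩
    rw [hb, LinearMap.comp_apply, hk, map_sub, hN.zero, sub_zero, hn]

/-- The cokernels of an injective map of short exact sequences form a short exact sequence. -/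
theorem exists_cokernels {s : N₁ →ₗ[R] N} {t : N →ₗ[R] N₂} {x₁ : A →ₗ[R] N₁} {q₁ : N₁ →ₗ[R] K₁}
    {x₂ : C →ₗ[R] N₂} {q₂ : N₂ →ₗ[R] K₂} (h : IsShortExact f g) (hN : IsShortExact s t)
    (h₁ : IsShortExact x₁ q₁) (h₂ : IsShortExact x₂ q₂) (x : B →ₗ[R] N)
    (hs : ∀ a, x (f a) = s (x₁ a)) (ht : ∀ b, t (x b) = x₂ (g b)) :
    ∃ (K : ModuleCat.{u} R) (q : N →ₗ[R] K) (a : K₁ →ₗ[R] K) (b : K →ₗ[R] K₂),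
      IsShortExact x q ∧ IsShortExact a b := by
  have hx : Function.Injective x := by
    refine (injective_iff_map_eq_zero _).2 fun b hb => ?_
    obtain ⟨a, rfl⟩ := h.exact (b := b) (h₂.1 (by rw [← ht, hb, map_zero, map_zero]))
    rw [hs] at hb
    rw [h₁.1 (hN.1 (hb.trans (by rw [map_zero, map_zero]))) , map_zero]
  have hq := of_injective hx
  set q : N →ₗ[R] ModuleCat.of R (N ⧸ LinearMap.range x) := (LinearMap.range x).mkQ
  obtain ⟨a, ha⟩ := h₁.desc (q ∘ₗ s) (fun k => by
    rw [LinearMap.comp_apply, ← hs, hq.zero])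
  obtain ⟨b, hb⟩ := hq.desc (q₂ ∘ₗ t) (fun k => by
    rw [LinearMap.comp_apply, ht, h₂.zero])
  refine ⟨_, q, a, b, hq, mk' ?_ ?_ ?_ ?_⟩
  · refine (injective_iff_map_eq_zero _).2 fun k hk => ?_
    obtain ⟨n₁, rfl⟩ := h₁.2.2 k
    rw [ha] at hk
    obtain ⟨m, hm⟩ := hq.exact hk
    obtain ⟨c, rfl⟩ := h.exact (b := m) (h₂.1 (by rw [← ht, hm, hN.zero, map_zero]))
    rw [hs] at hm
    rw [← hN.1 hm, h₁.zero]
  · intro k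
    obtain ⟨n₁, rfl⟩ := h₁.2.2 k
    rw [ha, LinearMap.comp_apply, hb, LinearMap.comp_apply, hN.zero, map_zero]
  · intro k hk
    obtain ⟨n, rfl⟩ := hq.2.2 k
    rw [hb] at hk
    obtain ⟨c, hc⟩ := h₂.exact hk
    obtain ⟨m, rfl⟩ := h.2.2 c
    obtain ⟨n₁, hn₁⟩ := hN.exact (b := n - x m) (by rw [map_sub, ht, hc, sub_self])
    exact ⟨q₁ n₁, by rw [ha, LinearMap.comp_apply, hn₁, map_sub, hq.zero, sub_zero]⟩
  · intro k₂
    obtain ⟨n₂, rfl⟩ := h₂.2.2 k₂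
    obtain ⟨n, rfl⟩ := hN.2.2 n₂
    exact ⟨q n, hb n⟩

end IsShortExact

/-! ### Extension classes and orthogonality -/

/-- The middle terms of short exact sequences with left term in `U` and right term in `V`. -/
def star (U V : ModuleCat.{u} R → Prop) (M : ModuleCat.{u} R) : Prop :=
  ∃ (B C : ModuleCat.{u} R) (f : B →ₗ[R] M) (g : M →ₗ[R] C), U B ∧ V C ∧ IsShortExact f g

/-- The class of zero modules. -/
def zeroClass (M : ModuleCat.{u} R) : Prop := Subsingleton M

/-- A class of modules is closed under isomorphisms. -/
def IsoClosed (U : ModuleCat.{u} R → Prop) : Prop :=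
  ∀ M N : ModuleCat.{u} R, (M ≃ₗ[R] N) → U M → U N

/-- The `n`-fold power of `U` with respect to `star`. -/
def starPow (U : ModuleCat.{u} R → Prop) : ℕ → ModuleCat.{u} R → Prop
  | 0 => zeroClass
  | n + 1 => star U (starPow U n)

theorem star_mono {U U' V V' : ModuleCat.{u} R → Prop} (hU : ∀ M, U M → U' M)
    (hV : ∀ M, V M → V' M) (M : ModuleCat.{u} R) : star U V M → star U' V' M := by
  rintro ⟨B, C, f, g, hB, hC, h⟩
  exact ⟨B, C, f, g, hU B hB, hV C hC, h⟩

theorem starPow_mono {U U' : ModuleCat.{u} R → Prop} (hU : ∀ M, U M → U' M) (n : ℕ) :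
    ∀ M, starPow U n M → starPow U' n M := by
  induction n with
  | zero => exact fun M h => h
  | succ n ih => exact star_mono hU ih

theorem IsoClosed.star (U V : ModuleCat.{u} R → Prop) : IsoClosed (star U V) := by
  rintro M N e ⟨B, C, f, g, hB, hC, h⟩
  exact ⟨B, C, _, _, hB, hC, h.equiv_middle e⟩

theorem IsoClosed.zeroClass : IsoClosed (zeroClass (R := R)) :=
  fun _ _ e (_ : Subsingleton _) => e.symm.injective.subsingleton

theorem IsoClosed.starPow (U : ModuleCat.{u} R → Prop) (n : ℕ) : IsoClosed (starPow U n) := by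
  cases n with
  | zero => exact IsoClosed.zeroClass
  | succ n => exact IsoClosed.star _ _

theorem star_zeroClass {U : ModuleCat.{u} R → Prop} (hU : IsoClosed U) {M : ModuleCat.{u} R}
    (h : star U zeroClass M) : U M := by
  obtain ⟨B, C, f, g, hB, hC, h⟩ := h
  have : Subsingleton C := hC
  exact hU B M (LinearEquiv.ofBijective f h.bijective_left) hB

theorem zeroClass_star {U : ModuleCat.{u} R → Prop} (hU : IsoClosed U) {M : ModuleCat.{u} R}
    (h : star zeroClass U M) : U M := by
  obtain ⟨B, C, f, g, hB, hC, h⟩ := h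
  have : Subsingleton B := hB
  exact hU C M (LinearEquiv.ofBijective g h.bijective_right).symm hC

/-- For D ⊆ B ⊆ M, the quotient M/D is an extension of M/B by B/D. Here M/D is realised as the
pushout of B → M along B → B/D. -/
theorem star_assoc {U V W : ModuleCat.{u} R → Prop} {M : ModuleCat.{u} R}
    (h : star (star U V) W M) : star U (star V W) M := by
  obtain ⟨B, C, f, g, ⟨D, E, f', g', hD, hE, h'⟩, hC, h⟩ := h
  obtain ⟨Q, i, j, q, hiq, hc, hq, hs, hk, -⟩ := h.exists_pushout g'
  refine ⟨D, Q, f ∘ₗ f', j, hD, ⟨E, C, i, q, hE, hC, hiq⟩, .mk' (h.1.comp h'.1) (fun d => ?_)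
    (fun b hb => ?_) (fun e => ?_)⟩
  · rw [LinearMap.comp_apply, ← hc, h'.zero, map_zero]
  · obtain ⟨a, ha, rfl⟩ := hk 0 b (by rw [hb, map_zero])
    obtain ⟨d, rfl⟩ := h'.exact ha
    exact ⟨d, rfl⟩
  · obtain ⟨d, b, rfl⟩ := hs e
    obtain ⟨a, rfl⟩ := h'.2.2 d
    exact ⟨f a + b, by rw [map_add, hc]⟩

theorem starPow_star {U : ModuleCat.{u} R → Prop} (hU : IsoClosed U) (n : ℕ) :
    ∀ M, star (starPow U n) U M → starPow U (n + 1) M := by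
  induction n with
  | zero =>
    intro M h
    exact ⟨M, ModuleCat.of R PUnit, _, _, zeroClass_star hU h, inferInstanceAs (Subsingleton PUnit),
      IsShortExact.id_right M _⟩
  | succ n ih => exact fun M h => star_mono (fun _ => id) ih _ (star_assoc h)

/-- `Ext¹(X', K) = 0` for all `X'` in `𝓧`. -/
def RightPerp (X : ModuleCat.{u} R → Prop) (K : ModuleCat.{u} R) : Prop :=
  ∀ (E X' : ModuleCat.{u} R) (i : K →ₗ[R] E) (g : E →ₗ[R] X'), X X' → IsShortExact i g →
    ∃ s : X' →ₗ[R] E, ∀ x, g (s x) = x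

/-- `Ext¹(K, X') = 0` for all `X'` in `𝓧`. -/
def LeftPerp (X : ModuleCat.{u} R → Prop) (K : ModuleCat.{u} R) : Prop :=
  ∀ (E X' : ModuleCat.{u} R) (i : X' →ₗ[R] E) (g : E →ₗ[R] K), X X' → IsShortExact i g →
    ∃ r : E →ₗ[R] X', ∀ x, r (i x) = x

section

variable {X : ModuleCat.{u} R → Prop} {A B C : ModuleCat.{u} R} {f : A →ₗ[R] B} {g : B →ₗ[R] C}

/-- Vanishing of Ext¹(X', A) as a lifting property: a section of the sequence pulled back along `t`
is a lift of `t`. -/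
theorem RightPerp.exists_lift (hA : RightPerp X A) (h : IsShortExact f g) {X' : ModuleCat.{u} R}
    (hX' : X X') (t : X' →ₗ[R] C) : ∃ s : X' →ₗ[R] B, ∀ x, g (s x) = t x := by
  obtain ⟨E, i, p, q, hE, hc, -⟩ := h.exists_pullback t
  obtain ⟨s, hs⟩ := hA E X' i q hX' hE
  exact ⟨p ∘ₗ s, fun x => by rw [LinearMap.comp_apply, hc, hs]⟩

theorem LeftPerp.exists_extend (hC : LeftPerp X C) (h : IsShortExact f g) {X' : ModuleCat.{u} R}
    (hX' : X X') (t : A →ₗ[R] X') : ∃ s : B →ₗ[R] X', ∀ x, s (f x) = t x := by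
  obtain ⟨E, i, j, q, hE, hc, -⟩ := h.exists_pushout t
  obtain ⟨r, hr⟩ := hC E X' i q hX' hE
  exact ⟨r ∘ₗ j, fun x => by rw [LinearMap.comp_apply, ← hc, hr]⟩

/-- Exactness of Ext¹(X', A) → Ext¹(X', B) → Ext¹(X', C), done by hand: an extension of X' by B
splits after pushing out to C, and the section lifts back because E → E' is onto with kernel A. -/
theorem RightPerp.of_isShortExact (h : IsShortExact f g) (hA : RightPerp X A)
    (hC : RightPerp X C) : RightPerp X B := by
  intro E X' i q hX' hE
  obtain ⟨E', i', j, q', hE', hc, hq, hs, hk, -⟩ := hE.exists_pushout g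
  obtain ⟨s', hs'⟩ := hC E' X' i' q' hX' hE'
  have hj : IsShortExact (i ∘ₗ f) j := by
    refine .mk' (hE.1.comp h.1) (fun a => ?_) (fun e he => ?_) (fun e => ?_)
    · rw [LinearMap.comp_apply, ← hc, h.zero, map_zero]
    · obtain ⟨b, hb, rfl⟩ := hk 0 e (by rw [he, map_zero])
      obtain ⟨a, rfl⟩ := h.exact hb
      exact ⟨a, rfl⟩
    · obtain ⟨c, e', rfl⟩ := hs e
      obtain ⟨b, rfl⟩ := h.2.2 c
      exact ⟨i b + e', by rw [map_add, hc]⟩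
  obtain ⟨t, ht⟩ := hA.exists_lift hj hX' s'
  exact ⟨t, fun x => by rw [← hq, ht, hs']⟩

theorem LeftPerp.of_isShortExact (h : IsShortExact f g) (hA : LeftPerp X A)
    (hC : LeftPerp X C) : LeftPerp X B := by
  intro E X' i q hX' hE
  obtain ⟨E', i', p, q', hE', hc, hp, hinj, hk, -⟩ := hE.exists_pullback f
  obtain ⟨r', hr'⟩ := hA E' X' i' q' hX' hE'
  have hj : IsShortExact p (g ∘ₗ q) := by
    refine .mk' ((injective_iff_map_eq_zero _).2 fun e he => hinj e he (h.1 ?_)) (fun a => ?_)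
      (fun e he => ?_) (h.2.2.comp hE.2.2)
    · rw [← hc, he, map_zero, map_zero]
    · rw [LinearMap.comp_apply, hc, h.zero]
    · obtain ⟨a, ha⟩ := h.exact he
      obtain ⟨e', rfl, -⟩ := hk e a ha.symm
      exact ⟨e', rfl⟩
  obtain ⟨t, ht⟩ := hC.exists_extend hj hX' r'
  exact ⟨t, fun x => by rw [← hp, ht, hr']⟩

theorem RightPerp.of_subsingleton (X : ModuleCat.{u} R → Prop) (K : ModuleCat.{u} R)
    [Subsingleton K] : RightPerp X K := fun _ _ _ g _ h =>
  ⟨(LinearEquiv.ofBijective g h.bijective_right).symm.toLinearMap, fun x =>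
    LinearEquiv.apply_symm_apply (LinearEquiv.ofBijective g h.bijective_right) x⟩

theorem LeftPerp.of_subsingleton (X : ModuleCat.{u} R → Prop) (K : ModuleCat.{u} R)
    [Subsingleton K] : LeftPerp X K := fun _ _ i _ _ h =>
  ⟨(LinearEquiv.ofBijective i h.bijective_left).symm.toLinearMap, fun x =>
    LinearEquiv.symm_apply_apply (LinearEquiv.ofBijective i h.bijective_left) x⟩

/-- Wakamatsu's lemma for minimal right approximations. -/
theorem IsMinRightApprox.rightPerp (hX : ClosedUnderExtensions X) (hg : IsMinRightApprox X g)
    (h : IsShortExact f g) : RightPerp X A := by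
  intro E X' a q hX' hE
  obtain ⟨E', i, j, q', hE', hc, -, -, -, hd⟩ := hE.exists_pushout f
  obtain ⟨d, hdi, hdj⟩ := hd C g 0 (fun a => by simp [h.zero])
  -- The pushout `E'` is an extension of `X'` by `B`, hence in 𝓧, so `d` factors through the
  -- approximation `g`. Then `k ∘ i` is an endomorphism over `g`, an automorphism by minimality;
  -- correcting `k ∘ j` by its inverse gives a map `E → A` that retracts the inclusion of `A`.
  obtain ⟨k, hk⟩ := hg.lift E' (hX B E' X' i q' hE' hg.mem hX') d
  have hk' : ∀ x, g (k x) = d x := LinearMap.congr_fun hk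
  have hb := hg.minimal (k ∘ₗ i) (LinearMap.ext fun b => by simp [hk', hdi])
  let φ := LinearEquiv.ofBijective (k ∘ₗ i) hb
  have hφ : ∀ b, g (φ.symm b) = g b := fun b => by
    conv_rhs => rw [← φ.apply_symm_apply b]
    rw [LinearEquiv.ofBijective_apply, LinearMap.comp_apply, hk', hdi]
  obtain ⟨r, hr⟩ := h.lift (φ.symm.toLinearMap ∘ₗ k ∘ₗ j) (fun e => by
    simp [hφ, hk', hdj])
  refine hE.exists_section (r := r) fun x => h.1 ?_
  rw [hr]
  simp only [LinearMap.comp_apply, ← hc]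
  exact φ.symm_apply_apply (f x)

/-- Wakamatsu's lemma for minimal left approximations. -/
theorem IsMinLeftApprox.leftPerp (hX : ClosedUnderExtensions X) (hf : IsMinLeftApprox X f)
    (h : IsShortExact f g) : LeftPerp X C := by
  intro E X' a q hX' hE
  obtain ⟨E', i, p, q', hE', hc, -, -, -, hd⟩ := hE.exists_pullback g
  obtain ⟨d, hdp, hdq⟩ := hd A 0 f (fun a => by simp [h.zero])
  -- Here the pullback `E'` is in 𝓧 as an extension of `B` by `X'`. The endomorphism `q' ∘ k` of `B`
  -- fixes `f` and so is invertible by minimality, and `p ∘ k` corrected by its inverse descends to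
  -- a section of `q`.
  obtain ⟨k, hk⟩ := hf.desc E' (hX X' E' B i q' hE' hX' hf.mem) d
  have hk' : ∀ x, k (f x) = d x := LinearMap.congr_fun hk
  have hb := hf.minimal (q' ∘ₗ k) (LinearMap.ext fun b => by simp [hk', hdq])
  let φ := LinearEquiv.ofBijective (q' ∘ₗ k) hb
  have hφ : ∀ b, φ.symm (f b) = f b := fun b => by
    rw [LinearEquiv.symm_apply_eq, LinearEquiv.ofBijective_apply, LinearMap.comp_apply, hk', hdq]
  obtain ⟨r, hr⟩ := h.desc (p ∘ₗ k ∘ₗ φ.symm.toLinearMap) (fun e => by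
    simp [hφ, hk', hdp])
  refine hE.exists_retraction (s := r) fun x => ?_
  obtain ⟨b, rfl⟩ := h.2.2 x
  rw [hr]
  simp only [LinearMap.comp_apply, hc]
  exact congrArg g (φ.apply_symm_apply b)

end

/-! ### Relative syzygies of extensions -/

/-- Every module in `W` has an `𝓧`-cover whose kernel is in `W'` and right orthogonal to `𝓧`. -/
def RTrans (X W W' : ModuleCat.{u} R → Prop) : Prop :=
  ∀ M, W M → ∃ (K N : ModuleCat.{u} R) (i : K →ₗ[R] N) (f : N →ₗ[R] M),
    W' K ∧ X N ∧ RightPerp X K ∧ IsShortExact i f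

/-- Every module in `W` embeds in a module of `𝓧` with cokernel in `W'` and left orthogonal to
`𝓧`. -/
def LTrans (X W W' : ModuleCat.{u} R → Prop) : Prop :=
  ∀ M, W M → ∃ (N K : ModuleCat.{u} R) (i : M →ₗ[R] N) (f : N →ₗ[R] K),
    X N ∧ W' K ∧ LeftPerp X K ∧ IsShortExact i f

variable (R) in
/-- Every module in `mod R` embeds in an injective module of `mod R`. -/
def EnoughFiniteInjectives : Prop :=
  ∀ M : ModuleCat.{u} R, Module.Finite R M → ∃ (I : ModuleCat.{u} R) (f : M →ₗ[R] I),
    Module.Finite R I ∧ Module.Injective R I ∧ Function.Injective f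

section

variable {X W₁ W₁' W₂ W₂' : ModuleCat.{u} R → Prop}

/-- Relative horseshoe lemma. `N₂` need not be projective, so the middle cover is built from a free
cover P → N₂ with kernel L in 𝓧: lift P to B, restrict to L → A, lift that to L → N₁ using Ext¹(L,
K₁) = 0, and push out P along it. -/
theorem RTrans.star (hX : IsSubcategory X) (hr : IsResolving X)
    (h₁ : RTrans X W₁ W₁') (h₂ : RTrans X W₂ W₂') : RTrans X (star W₁ W₂) (star W₁' W₂') := by
  rintro B ⟨A, C, ι, π, hA, hC, h⟩
  obtain ⟨K₁, N₁, i₁, x₁, hK₁, hN₁, hp₁, hs₁⟩ := h₁ A hA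
  obtain ⟨K₂, N₂, i₂, x₂, hK₂, hN₂, hp₂, hs₂⟩ := h₂ C hC
  have := hX.finite _ hN₂
  obtain ⟨n, q, hq⟩ := Module.Finite.exists_fin' R N₂
  let P := ModuleCat.of R (Fin n → R)
  change P →ₗ[R] N₂ at q
  have hP : X P := hr.projective _ (inferInstanceAs (Module.Finite R (Fin n → R)))
    (inferInstanceAs (Module.Projective R (Fin n → R)))
  have hq' := IsShortExact.of_surjective (g := q) hq
  set L := ModuleCat.of R (LinearMap.ker q)
  have hL : X L := hr.ker _ _ _ _ _ hq' hP hN₂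
  obtain ⟨s, hs⟩ := Module.projective_lifting_property π (x₂ ∘ₗ q) h.2.2
  have hs' : ∀ x, π (s x) = x₂ (q x) := LinearMap.congr_fun hs
  obtain ⟨t, ht⟩ := h.lift (T := L) (s ∘ₗ (LinearMap.ker q).subtype) (fun x => by
    rw [LinearMap.comp_apply, hs', hq'.zero, map_zero])
  obtain ⟨w, hw⟩ := hp₁.exists_lift hs₁ hL t
  obtain ⟨E, i, j, g, hE, hc, hj, hsE, -, hd⟩ := hq'.exists_pushout w
  obtain ⟨d, hdi, hdj⟩ := hd B (ι ∘ₗ x₁) s (fun a => by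
    rw [LinearMap.comp_apply, hw, ht, LinearMap.comp_apply])
  obtain ⟨K, k, a, b, hk, hab⟩ := h.exists_kernels hE hs₁ hs₂ d hdi (fun e => by
    obtain ⟨n, p, rfl⟩ := hsE e
    rw [map_add, map_add, map_add, hdi, hdj, hj, hE.zero, LinearMap.comp_apply, h.zero, hs',
      zero_add, zero_add])
  exact ⟨K, E, k, d, ⟨K₁, K₂, a, b, hK₁, hK₂, hab⟩, hr.ext _ _ _ _ _ hE hN₁ hN₂,
    .of_isShortExact hab hp₁ hp₂, hk⟩

/-- Dual horseshoe: embed `N₁` in an injective I with cokernel L in 𝓧. The obstruction Ext²(K₂, N₁)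
= Ext¹(K₂, L) vanishes since `K₂` is left orthogonal to 𝓧. -/
theorem LTrans.star (hI : EnoughFiniteInjectives R) (hX : IsSubcategory X) (hr : IsCoresolving X)
    (h₁ : LTrans X W₁ W₁') (h₂ : LTrans X W₂ W₂') : LTrans X (star W₁ W₂) (star W₁' W₂') := by
  rintro B ⟨A, C, ι, π, hA, hC, h⟩
  obtain ⟨N₁, K₁, x₁, q₁, hN₁, hK₁, hp₁, hs₁⟩ := h₁ A hA
  obtain ⟨N₂, K₂, x₂, q₂, hN₂, hK₂, hp₂, hs₂⟩ := h₂ C hC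
  obtain ⟨I, e, hIf, hIi, he⟩ := hI N₁ (hX.finite _ hN₁)
  have hP : X I := hr.injective _ hIf hIi
  have he' := IsShortExact.of_injective (f := e) he
  set L := ModuleCat.of R (I ⧸ LinearMap.range e)
  have hL : X L := hr.coker _ _ _ _ _ he' hN₁ hP
  obtain ⟨s, hs⟩ := hIi.out ι h.1 (e ∘ₗ x₁)
  obtain ⟨t, ht⟩ := h.desc (T := L) ((LinearMap.range e).mkQ ∘ₗ s) (fun x => by
    rw [LinearMap.comp_apply, hs, LinearMap.comp_apply, he'.zero])
  obtain ⟨w, hw⟩ := hp₂.exists_extend hs₂ hL t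
  obtain ⟨E, i, p, g, hE, hc, hp, hinj, -, hd⟩ := he'.exists_pullback w
  obtain ⟨d, hdp, hdg⟩ := hd B s (x₂ ∘ₗ π) (fun a => by
    rw [LinearMap.comp_apply, hw, ht, LinearMap.comp_apply])
  obtain ⟨K, k, a, b, hk, hab⟩ := h.exists_cokernels hE hs₁ hs₂ d (fun x => by
    refine sub_eq_zero.1 (hinj _ ?_ ?_)
    · rw [map_sub, hdp, hs, hp, LinearMap.comp_apply, sub_self]
    · rw [map_sub, hdg, LinearMap.comp_apply, h.zero, hE.zero, map_zero, sub_self]) hdg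
  exact ⟨E, K, d, k, hr.ext _ _ _ _ _ hE hN₁ hN₂, ⟨K₁, K₂, a, b, hK₁, hK₂, hab⟩,
    .of_isShortExact hab hp₁ hp₂, hk⟩

theorem RTrans.zeroClass (X : ModuleCat.{u} R → Prop) : RTrans X X zeroClass := fun M hM =>
  ⟨ModuleCat.of R PUnit, M, _, _, inferInstanceAs (Subsingleton PUnit), hM,
    have : Subsingleton (ModuleCat.of R PUnit.{u + 1}) := inferInstanceAs (Subsingleton PUnit)
    .of_subsingleton _ _, IsShortExact.id_left M _⟩

theorem LTrans.zeroClass (X : ModuleCat.{u} R → Prop) : LTrans X X zeroClass := fun M hM =>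
  ⟨M, ModuleCat.of R PUnit, _, _, hM, inferInstanceAs (Subsingleton PUnit),
    have : Subsingleton (ModuleCat.of R PUnit.{u + 1}) := inferInstanceAs (Subsingleton PUnit)
    .of_subsingleton _ _, IsShortExact.id_right M _⟩

/-- Modules filtered by `n` layers, each with a sub from `U` and a quotient from `W`, above a
submodule from `W`. -/
def layered (W U : ModuleCat.{u} R → Prop) : ℕ → ModuleCat.{u} R → Prop
  | 0 => W
  | n + 1 => ExtDimension.star (ExtDimension.star (layered W U n) U) W

variable {W U W' U' : ModuleCat.{u} R → Prop}

theorem layered_mono (hW : ∀ M, W M → W' M) (n : ℕ) :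
    ∀ M, layered W U n M → layered W' U n M := by
  induction n with
  | zero => exact hW
  | succ n ih => exact star_mono (star_mono ih fun _ => id) hW

theorem RTrans.layered (hX : IsSubcategory X) (hr : IsResolving X)
    (hW : RTrans X W W') (hU : RTrans X U U') (n : ℕ) :
    RTrans X (layered W U n) (layered W' U' n) := by
  induction n with
  | zero => exact hW
  | succ n ih => exact (ih.star hX hr hU).star hX hr hW

theorem LTrans.layered (hI : EnoughFiniteInjectives R) (hX : IsSubcategory X)
    (hr : IsCoresolving X) (hW : LTrans X W W') (hU : LTrans X U U') (n : ℕ) :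
    LTrans X (layered W U n) (layered W' U' n) := by
  induction n with
  | zero => exact hW
  | succ n ih => exact (ih.star hI hX hr hU).star hI hX hr hW

theorem RTrans.starPow (hX : IsSubcategory X) (hr : IsResolving X)
    (hU : RTrans X U U') (n : ℕ) : RTrans X (starPow U n) (starPow U' n) := by
  induction n with
  | zero => exact fun M hM => RTrans.zeroClass X M (hX.zero M hM)
  | succ n ih => exact hU.star hX hr ih

theorem LTrans.starPow (hI : EnoughFiniteInjectives R) (hX : IsSubcategory X)
    (hr : IsCoresolving X) (hU : LTrans X U U') (n : ℕ) :
    LTrans X (starPow U n) (starPow U' n) := by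
  induction n with
  | zero => exact fun M hM => LTrans.zeroClass X M (hX.zero M hM)
  | succ n ih => exact hU.star hI hX hr ih

/-- Once the `W`-layers vanish only the `n` layers from `U` are left. They are bracketed from the
left in `layered` and from the right in `starPow`, so associativity is needed. -/
theorem layered_zeroClass (hU : IsoClosed U) (n : ℕ) :
    ∀ M, ExtDimension.layered zeroClass U n M → ExtDimension.starPow U n M := by
  induction n with
  | zero => exact fun M h => h
  | succ n ih =>
    exact fun M h => starPow_star hU n M
      (star_mono ih (fun _ => id) _ (star_zeroClass (IsoClosed.star _ _) h))

/-! ### Modules with finite relative resolutions -/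

/-- Modules with an `𝓧`-resolution of length `m` by covers with right orthogonal kernels. -/
def resDim (X : ModuleCat.{u} R → Prop) : ℕ → ModuleCat.{u} R → Prop
  | 0 => X
  | m + 1 => fun M => ∃ (K N : ModuleCat.{u} R) (i : K →ₗ[R] N) (f : N →ₗ[R] M),
      resDim X m K ∧ X N ∧ RightPerp X K ∧ IsShortExact i f

/-- Modules with an `𝓧`-coresolution of length `m` by envelopes with left orthogonal cokernels. -/
def coresDim (X : ModuleCat.{u} R → Prop) : ℕ → ModuleCat.{u} R → Prop
  | 0 => X
  | m + 1 => fun M => ∃ (N K : ModuleCat.{u} R) (i : M →ₗ[R] N) (f : N →ₗ[R] K),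
      X N ∧ coresDim X m K ∧ LeftPerp X K ∧ IsShortExact i f

theorem IsSubcategory.isoClosed (hX : IsSubcategory X) : IsoClosed X := fun M N e h =>
  hX.summand N M e.symm.toLinearMap e.toLinearMap (by ext; simp) h

theorem resDim_succ (hX : IsSubcategory X) (m : ℕ) :
    ∀ M, resDim X m M → resDim X (m + 1) M := by
  induction m with
  | zero =>
    intro M hM
    obtain ⟨K, N, i, f, hK, h⟩ := RTrans.zeroClass X M hM
    exact ⟨K, N, i, f, hX.zero K hK, h⟩
  | succ m ih =>
    rintro M ⟨K, N, i, f, hK, h⟩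
    exact ⟨K, N, i, f, ih K hK, h⟩

theorem resDim_le (hX : IsSubcategory X) {m m' : ℕ} (h : m ≤ m') :
    ∀ M, resDim X m M → resDim X m' M := by
  induction h with
  | refl => exact fun M h => h
  | step _ ih => exact fun M hM => resDim_succ hX _ M (ih M hM)

theorem coresDim_succ (hX : IsSubcategory X) (m : ℕ) :
    ∀ M, coresDim X m M → coresDim X (m + 1) M := by
  induction m with
  | zero =>
    intro M hM
    obtain ⟨N, K, i, f, hN, hK, h⟩ := LTrans.zeroClass X M hM
    exact ⟨N, K, i, f, hN, hX.zero K hK, h⟩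
  | succ m ih =>
    rintro M ⟨N, K, i, f, hN, hK, h⟩
    exact ⟨N, K, i, f, hN, ih K hK, h⟩

theorem coresDim_le (hX : IsSubcategory X) {m m' : ℕ} (h : m ≤ m') :
    ∀ M, coresDim X m M → coresDim X m' M := by
  induction h with
  | refl => exact fun M h => h
  | step _ ih => exact fun M hM => coresDim_succ hX _ M (ih M hM)

theorem resDim_isoClosed (hX : IsSubcategory X) (m : ℕ) : IsoClosed (resDim X m) := by
  cases m with
  | zero => exact hX.isoClosed
  | succ m =>
    rintro M M' e ⟨K, N, i, f, hK, hN, hp, h⟩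
    exact ⟨K, N, i, _, hK, hN, hp, h.equiv_right e⟩

theorem coresDim_isoClosed (hX : IsSubcategory X) (m : ℕ) : IsoClosed (coresDim X m) := by
  cases m with
  | zero => exact hX.isoClosed
  | succ m =>
    rintro M M' e ⟨N, K, i, f, hN, hK, hp, h⟩
    exact ⟨N, K, _, f, hN, hK, hp, by simpa using h.equiv_left e.symm⟩

/-- Induction by the horseshoe lemma: `resDim X (m + 1)` is by definition the class of modules
having an orthogonal cover with kernel in `resDim X m`. -/
theorem resDim_star (hX : IsSubcategory X) (hr : IsResolving X) (m : ℕ) :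
    ∀ M, ExtDimension.star (resDim X m) (resDim X m) M → resDim X m M := by
  induction m with
  | zero =>
    rintro M ⟨A, C, f, g, hA, hC, h⟩
    exact hr.ext _ _ _ _ _ h hA hC
  | succ m ih =>
    intro M hM
    have h : RTrans X (resDim X (m + 1)) (resDim X m) := fun M h => h
    obtain ⟨K, N, i, f, hK, h⟩ := h.star hX hr h M hM
    exact ⟨K, N, i, f, ih K hK, h⟩

theorem coresDim_star (hI : EnoughFiniteInjectives R) (hX : IsSubcategory X)
    (hr : IsCoresolving X) (m : ℕ) :
    ∀ M, ExtDimension.star (coresDim X m) (coresDim X m) M → coresDim X m M := by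
  induction m with
  | zero =>
    rintro M ⟨A, C, f, g, hA, hC, h⟩
    exact hr.ext _ _ _ _ _ h hA hC
  | succ m ih =>
    intro M hM
    have h : LTrans X (coresDim X (m + 1)) (coresDim X m) := fun M h => h
    obtain ⟨N, K, i, f, hN, hK, h⟩ := h.star hI hX hr h M hM
    exact ⟨N, K, i, f, hN, ih K hK, h⟩

theorem IsMinRightApprox.surjective (hr : IsResolving X) {N M : ModuleCat.{u} R}
    (hM : Module.Finite R M) {f : N →ₗ[R] M} (hf : IsMinRightApprox X f) :
    Function.Surjective f := by
  obtain ⟨n, q, hq⟩ := Module.Finite.exists_fin' R M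
  obtain ⟨h, hh⟩ := hf.lift (ModuleCat.of R (Fin n → R)) (hr.projective _
    (inferInstanceAs (Module.Finite R (Fin n → R)))
    (inferInstanceAs (Module.Projective R (Fin n → R)))) q
  refine Function.Surjective.of_comp (g := h) ?_
  rwa [← LinearMap.coe_comp, hh]

theorem IsMinLeftApprox.injective (hI : EnoughFiniteInjectives R) (hr : IsCoresolving X)
    {N M : ModuleCat.{u} R} (hM : Module.Finite R M) {f : M →ₗ[R] N} (hf : IsMinLeftApprox X f) :
    Function.Injective f := by
  obtain ⟨I, e, hIf, hIi, he⟩ := hI M hM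
  obtain ⟨h, hh⟩ := hf.desc I (hr.injective I hIf hIi) e
  refine Function.Injective.of_comp (f := h) ?_
  rwa [← LinearMap.coe_comp, hh]

/-- Minimal approximations are onto because 𝓧 contains the free modules, and their kernels are
orthogonal to 𝓧 by Wakamatsu's lemma. So an iterated syzygy in 𝓧 yields a resolution of the kind
used in the horseshoe argument. -/
theorem resDim_of_isSyzygy [IsNoetherianRing R] (hX : IsSubcategory X) (hr : IsResolving X)
    {S : ModuleCat.{u} R} (hS : Module.Finite R S) (n : ℕ) : ∀ (K : ModuleCat.{u} R),
    IsSyzygy X n S K → Module.Finite R K ∧ ∀ m, resDim X m K → resDim X (m + n) S := by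
  induction n with
  | zero =>
    rintro K ⟨e⟩
    exact ⟨Module.Finite.equiv e.symm, fun m hK => resDim_isoClosed hX m _ _ e hK⟩
  | succ n ih =>
    rintro K ⟨L, hL, N, f, hf, ⟨e⟩⟩
    obtain ⟨hLf, hL⟩ := ih L hL
    have hs := IsShortExact.of_surjective (hf.surjective hr hLf)
    have hp := hf.rightPerp hr.ext hs
    refine ⟨?_, fun m hK => ?_⟩
    · have := hs.finite_left (hX.finite _ hf.mem)
      exact Module.Finite.equiv e.symm
    · have := hL (m + 1) ⟨_, _, _, _, resDim_isoClosed hX m _ _ e hK, hf.mem, hp, hs⟩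
      rwa [add_right_comm, add_assoc] at this

theorem coresDim_of_isCosyzygy (hI : EnoughFiniteInjectives R) (hX : IsSubcategory X)
    (hr : IsCoresolving X)
    {S : ModuleCat.{u} R} (hS : Module.Finite R S) (n : ℕ) : ∀ (K : ModuleCat.{u} R),
    IsCosyzygy X n S K → Module.Finite R K ∧ ∀ m, coresDim X m K → coresDim X (m + n) S := by
  induction n with
  | zero =>
    rintro K ⟨e⟩
    exact ⟨Module.Finite.equiv e.symm, fun m hK => coresDim_isoClosed hX m _ _ e hK⟩
  | succ n ih =>
    rintro K ⟨L, hL, N, f, hf, ⟨e⟩⟩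
    obtain ⟨hLf, hL⟩ := ih L hL
    have hs := IsShortExact.of_injective (hf.injective hI hr hLf)
    have hp := hf.leftPerp hr.ext hs
    refine ⟨?_, fun m hK => ?_⟩
    · have := hs.finite_right (hX.finite _ hf.mem)
      exact Module.Finite.equiv e.symm
    · have := hL (m + 1) ⟨_, _, _, _, hf.mem, coresDim_isoClosed hX m _ _ e hK, hp, hs⟩
      rwa [add_right_comm, add_assoc] at this

end

/-! ### Additive closures of a module -/

/-- The class `add A`. -/
abbrev addOf (A : ModuleCat.{u} R) : ModuleCat.{u} R → Prop := addClosure (isoClass A)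

theorem IsSubcategory.pi {X : ModuleCat.{u} R → Prop} (hX : IsSubcategory X) (n : ℕ) :
    ∀ (Y : Fin n → ModuleCat.{u} R), (∀ j, X (Y j)) → X (ModuleCat.of R (∀ j, Y j)) := by
  induction n with
  | zero => exact fun Y _ => hX.zero _ (inferInstanceAs (Subsingleton (∀ j, Y j)))
  | succ n ih =>
    intro Y hY
    have := hX.prod _ _ (hY 0) (ih (fun j => Y j.succ) fun j => hY _)
    exact hX.isoClosed _ _ (Fin.consLinearEquiv R (fun j => Y j)) this

theorem IsSubcategory.addClosure_le {X U : ModuleCat.{u} R → Prop} (hX : IsSubcategory X)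
    (hU : ∀ M, U M → X M) (M : ModuleCat.{u} R) (hM : addClosure U M) : X M := by
  obtain ⟨n, Y, hY, i, r, h⟩ := hM
  exact hX.summand _ _ i r h (hX.pi n Y fun j => hU _ (hY j))

theorem IsSubcategory.addOf_le {X : ModuleCat.{u} R → Prop} (hX : IsSubcategory X)
    {A : ModuleCat.{u} R} (hA : X A) (M : ModuleCat.{u} R) (hM : addOf A M) : X M :=
  hX.addClosure_le (fun _ ⟨e⟩ => hX.isoClosed _ _ e.symm hA) M hM

theorem addClosure_summand {U : ModuleCat.{u} R → Prop} {M N : ModuleCat.{u} R} (i : M →ₗ[R] N)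
    (r : N →ₗ[R] M) (h : r ∘ₗ i = LinearMap.id) (hN : addClosure U N) : addClosure U M := by
  obtain ⟨n, Y, hY, j, s, hs⟩ := hN
  refine ⟨n, Y, hY, j ∘ₗ i, r ∘ₗ s, ?_⟩
  rw [LinearMap.comp_assoc, ← LinearMap.comp_assoc i, hs, LinearMap.id_comp, h]

theorem subset_addClosure {U : ModuleCat.{u} R → Prop} {M : ModuleCat.{u} R} (hM : U M) :
    addClosure U M :=
  ⟨1, fun _ => M, fun _ => hM, LinearMap.pi fun _ => LinearMap.id, LinearMap.proj 0, rfl⟩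

theorem addOf_self (A : ModuleCat.{u} R) : addOf A A := subset_addClosure ⟨.refl R A⟩

theorem addOf_iff {A M : ModuleCat.{u} R} : addOf A M ↔
    ∃ (n : ℕ) (i : M →ₗ[R] (Fin n → A)) (r : (Fin n → A) →ₗ[R] M), ∀ x, r (i x) = x := by
  constructor
  · rintro ⟨n, Y, hY, i, r, h⟩
    let e := LinearEquiv.piCongrRight fun j => (hY j).some
    exact ⟨n, e.toLinearMap ∘ₗ i, r ∘ₗ e.symm.toLinearMap, fun x => by
      simpa using LinearMap.congr_fun h x⟩
  · rintro ⟨n, i, r, h⟩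
    exact ⟨n, fun _ => A, fun _ => ⟨.refl R A⟩, i, r, LinearMap.ext h⟩

theorem addOf_prod {A M N : ModuleCat.{u} R} (hM : addOf A M) (hN : addOf A N) :
    addOf A (ModuleCat.of R (M × N)) := by
  obtain ⟨m, i, r, h⟩ := addOf_iff.1 hM
  obtain ⟨n, i', r', h'⟩ := addOf_iff.1 hN
  let e : ((Fin (m + n)) → A) ≃ₗ[R] (Fin m → A) × (Fin n → A) :=
    (LinearEquiv.funCongrLeft R A finSumFinEquiv).trans
      (LinearEquiv.sumArrowLequivProdArrow (Fin m) (Fin n) R A)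
  refine addOf_iff.2 ⟨m + n, e.symm.toLinearMap ∘ₗ i.prodMap i', r.prodMap r' ∘ₗ e.toLinearMap,
    fun x => ?_⟩
  rw [LinearMap.comp_apply, LinearMap.comp_apply, LinearEquiv.coe_coe, LinearEquiv.coe_coe,
    e.apply_symm_apply]
  exact Prod.ext (h _) (h' _)

theorem addOf_zero (A : ModuleCat.{u} R) {M : ModuleCat.{u} R} (hM : Subsingleton M) : addOf A M :=
  addOf_iff.2 ⟨0, 0, 0, fun _ => Subsingleton.elim _ _⟩

theorem isSubcategory_addOf {A : ModuleCat.{u} R} (hA : Module.Finite R A) :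
    IsSubcategory (addOf A) where
  finite M hM := by
    obtain ⟨n, i, r, h⟩ := addOf_iff.1 hM
    exact Module.Finite.of_surjective r fun x => ⟨i x, h x⟩
  zero _ hM := addOf_zero A hM
  prod _ _ := addOf_prod
  summand _ _ i r h := addClosure_summand i r h

theorem addOf_trans {A B : ModuleCat.{u} R} (hA : Module.Finite R A) (hB : addOf A B) :
    ∀ M, addOf B M → addOf A M := (isSubcategory_addOf hA).addOf_le hB

theorem addOf_fst (A B : ModuleCat.{u} R) : addOf (ModuleCat.of R (A × B)) A :=
  addClosure_summand (N := ModuleCat.of R (A × B)) (LinearMap.inl R A B) (LinearMap.fst R A B)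
    (by ext; simp) (addOf_self _)

theorem addOf_snd (A B : ModuleCat.{u} R) : addOf (ModuleCat.of R (A × B)) B :=
  addClosure_summand (N := ModuleCat.of R (A × B)) (LinearMap.inr R A B) (LinearMap.snd R A B)
    (by ext; simp) (addOf_self _)

theorem isoClosed_addOf (A : ModuleCat.{u} R) : IsoClosed (addOf A) := fun _ _ e h =>
  addClosure_summand e.symm.toLinearMap e.toLinearMap (by ext; simp) h

theorem IsSubcategory.submodule {X : ModuleCat.{u} R → Prop} (hX : IsSubcategory X) {N : ModuleCat.{u} R} (hN : X N)
    {P Q : Submodule R N} (h : IsCompl P Q) : X (ModuleCat.of R P) :=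
  hX.summand _ _ P.subtype (P.projectionOnto Q h) (by ext; simp) hN

/-! ### Existence of minimal approximations -/

variable (R) in
/-- `Hom(A, M)` is finitely generated over `End A` and over `End M` for `A`, `M` in `mod R`. -/
def HomFinite : Prop :=
  ∀ A M : ModuleCat.{u} R, Module.Finite R A → Module.Finite R M →
    ∃ (m : ℕ) (g : Fin m → A →ₗ[R] M),
      (∀ h : A →ₗ[R] M, ∃ e : Fin m → A →ₗ[R] A, ∀ x, h x = ∑ j, g j (e j x)) ∧
      ∀ h : A →ₗ[R] M, ∃ e : Fin m → M →ₗ[R] M, ∀ x, h x = ∑ j, e j (g j x)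

section

variable [IsArtinianRing R] {X : ModuleCat.{u} R → Prop}

/-- Fitting's lemma. The range of `h ^ n` is proper for n ≥ 1, since on a module of finite length a
surjective endomorphism is bijective. -/
theorem exists_isCompl_of_not_bijective {N : ModuleCat.{u} R} (hN : Module.Finite R N)
    {h : N →ₗ[R] N} (hb : ¬ Function.Bijective h) : ∃ n : ℕ,
      IsCompl (LinearMap.range (h ^ n)) (LinearMap.ker (h ^ n)) ∧
      Module.length R (LinearMap.range (h ^ n)) < Module.length R N := by
  obtain ⟨n, hn, hn1⟩ := ((LinearMap.eventually_isCompl_ker_pow_range_pow h).and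
    (Filter.eventually_ge_atTop 1)).exists
  refine ⟨n, hn.symm, Submodule.length_lt fun ht => hb ?_⟩
  refine IsNoetherian.bijective_of_surjective_endomorphism h fun x => ?_
  obtain ⟨y, hy⟩ := LinearMap.range_eq_top.1 ht x
  obtain ⟨m, rfl⟩ := Nat.exists_eq_add_of_le' hn1
  rw [pow_succ'] at hy
  exact ⟨_, hy⟩

/-- Induction on length. If `f ∘ h = f` with `h` not bijective, then `f` restricted to the summand
`range (h ^ n)` is still an approximation, because `f ∘ h ^ n = f`. -/
theorem exists_isMinRightApprox_of_lift (hX : IsSubcategory X) {M : ModuleCat.{u} R} (ℓ : ℕ∞) :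
    ∀ {N : ModuleCat.{u} R} (f : N →ₗ[R] M), X N →
      (∀ X', X X' → ∀ g : X' →ₗ[R] M, ∃ h : X' →ₗ[R] N, ∀ x, f (h x) = g x) →
      Module.length R N = ℓ →
      ∃ (N' : ModuleCat.{u} R) (f' : N' →ₗ[R] M), IsMinRightApprox X f' := by
  induction ℓ using WellFoundedLT.induction with
  | ind ℓ ih =>
    intro N f hN hf hℓ
    by_cases hmin : ∀ h : N →ₗ[R] N, f ∘ₗ h = f → Function.Bijective h
    · exact ⟨N, f, hN, fun X' hX' g => (hf X' hX' g).imp fun h hh => LinearMap.ext hh, hmin⟩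
    push Not at hmin
    obtain ⟨h, hfh, hb⟩ := hmin
    obtain ⟨n, hc, hlt⟩ := exists_isCompl_of_not_bijective (hX.finite _ hN) hb
    have hpow : ∀ m x, f ((h ^ m) x) = f x := by
      intro m
      induction m with
      | zero => exact fun x => rfl
      | succ m ihm =>
        intro x
        rw [pow_succ, Module.End.mul_apply, ihm]
        exact LinearMap.congr_fun hfh x
    refine ih _ (hℓ ▸ hlt) (N := ModuleCat.of R (LinearMap.range (h ^ n)))
      (f ∘ₗ (LinearMap.range (h ^ n)).subtype) (hX.submodule hN hc) (fun X' hX' g => ?_) rfl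
    obtain ⟨k, hk⟩ := hf X' hX' g
    exact ⟨(h ^ n).rangeRestrict ∘ₗ k, fun x => (hpow n (k x)).trans (hk x)⟩

theorem exists_isMinLeftApprox_of_desc (hX : IsSubcategory X) {M : ModuleCat.{u} R} (ℓ : ℕ∞) :
    ∀ {N : ModuleCat.{u} R} (f : M →ₗ[R] N), X N →
      (∀ X', X X' → ∀ g : M →ₗ[R] X', ∃ h : N →ₗ[R] X', ∀ x, h (f x) = g x) →
      Module.length R N = ℓ →
      ∃ (N' : ModuleCat.{u} R) (f' : M →ₗ[R] N'), IsMinLeftApprox X f' := by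
  induction ℓ using WellFoundedLT.induction with
  | ind ℓ ih =>
    intro N f hN hf hℓ
    by_cases hmin : ∀ h : N →ₗ[R] N, h ∘ₗ f = f → Function.Bijective h
    · exact ⟨N, f, hN, fun X' hX' g => (hf X' hX' g).imp fun h hh => LinearMap.ext hh, hmin⟩
    push Not at hmin
    obtain ⟨h, hfh, hb⟩ := hmin
    obtain ⟨n, hc, hlt⟩ := exists_isCompl_of_not_bijective (hX.finite _ hN) hb
    have hpow : ∀ m x, (h ^ m) (f x) = f x := by
      intro m
      induction m with
      | zero => exact fun x => rfl
      | succ m ihm =>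
        intro x
        rw [pow_succ, Module.End.mul_apply, ← LinearMap.comp_apply h f, hfh, ihm]
    refine ih _ (hℓ ▸ hlt) (N := ModuleCat.of R (LinearMap.range (h ^ n)))
      (f.codRestrict (LinearMap.range (h ^ n)) fun x => ⟨f x, hpow n x⟩) (hX.submodule hN hc)
      (fun X' hX' g => ?_) rfl
    obtain ⟨k, hk⟩ := hf X' hX' g
    exact ⟨k ∘ₗ (LinearMap.range (h ^ n)).subtype, hk⟩

variable {A : ModuleCat.{u} R}

/-- Generators of Hom(A, M) over End A assemble to a map Aᵐ → M through which every map from A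
factors, hence every map from a summand of Aⁿ. Such an approximation can be cut down to a minimal
one. -/
theorem exists_isMinRightApprox (hH : HomFinite R) (hX : IsSubcategory X) (hA : X A)
    (hXA : ∀ M, X M → addOf A M) {M : ModuleCat.{u} R} (hM : Module.Finite R M) :
    ∃ (N : ModuleCat.{u} R) (f : N →ₗ[R] M), IsMinRightApprox X f := by
  obtain ⟨m, g, hg, -⟩ := hH A M (hX.finite A hA) hM
  have key : ∀ h : A →ₗ[R] M, ∃ t : A →ₗ[R] (Fin m → A), ∀ x,
      LinearMap.lsum R (fun _ => A) ℕ g (t x) = h x := by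
    intro h
    obtain ⟨e, he⟩ := hg h
    exact ⟨LinearMap.pi e, fun x => by simp [LinearMap.lsum_apply, he]⟩
  refine exists_isMinRightApprox_of_lift hX _ (N := ModuleCat.of R (Fin m → A))
    (LinearMap.lsum R (fun _ => A) ℕ g) (hX.pi m (fun _ => A) fun _ => hA)
    (fun X' hX' k => ?_) rfl
  obtain ⟨n, i, r, hr⟩ := addOf_iff.1 (hXA X' hX')
  choose t ht using fun j => key (k ∘ₗ r ∘ₗ LinearMap.single R (fun _ => A) j)
  refine ⟨LinearMap.lsum R (fun _ => A) ℕ t ∘ₗ i, fun x => ?_⟩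
  have : ∀ y, LinearMap.lsum R (fun _ => A) ℕ g (LinearMap.lsum R (fun _ => A) ℕ t y) = k (r y) := by
    intro y
    rw [LinearMap.lsum_apply R (fun _ => A) ℕ t]
    simp only [LinearMap.sum_apply, LinearMap.comp_apply, map_sum, ht, LinearMap.proj_apply]
    rw [← map_sum, ← map_sum]
    exact congrArg (fun z => k (r z)) (Finset.univ_sum_single y)
  rw [LinearMap.comp_apply]
  exact (this _).trans (by rw [hr])

theorem exists_isMinLeftApprox (hH : HomFinite R) (hX : IsSubcategory X) (hA : X A)
    (hXA : ∀ M, X M → addOf A M) {M : ModuleCat.{u} R} (hM : Module.Finite R M) :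
    ∃ (N : ModuleCat.{u} R) (f : M →ₗ[R] N), IsMinLeftApprox X f := by
  obtain ⟨m, g, -, hg⟩ := hH M A hM (hX.finite A hA)
  refine exists_isMinLeftApprox_of_desc hX _ (N := ModuleCat.of R (Fin m → A))
    (LinearMap.pi g) (hX.pi m (fun _ => A) fun _ => hA) (fun X' hX' k => ?_) rfl
  obtain ⟨n, i, r, hr⟩ := addOf_iff.1 (hXA X' hX')
  choose e he using fun j => hg (LinearMap.proj j ∘ₗ i ∘ₗ k)
  refine ⟨r ∘ₗ LinearMap.pi fun j => ∑ l, e j l ∘ₗ LinearMap.proj l, fun x => ?_⟩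
  rw [LinearMap.comp_apply, ← hr (k x)]
  congr 1
  funext j
  simpa using (he j x).symm

/-- Relative syzygies of the modules in `add B`. -/
theorem exists_rTrans_addOf (hH : HomFinite R) (hX : IsSubcategory X) (hr : IsResolving X)
    (hA : X A) (hXA : ∀ M, X M → addOf A M) {B : ModuleCat.{u} R} (hB : Module.Finite R B) :
    ∃ B' : ModuleCat.{u} R, Module.Finite R B' ∧ RTrans X (addOf B) (addOf B') := by
  obtain ⟨N₀, f₀, hf₀⟩ := exists_isMinRightApprox hH hX hA hXA hB
  have h₀ := IsShortExact.of_surjective (hf₀.surjective hr hB)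
  refine ⟨_, h₀.finite_left (hX.finite _ hf₀.mem), fun M hM => ?_⟩
  have hMf := (isSubcategory_addOf hB).finite M hM
  obtain ⟨N, f, hf⟩ := exists_isMinRightApprox hH hX hA hXA hMf
  have h := IsShortExact.of_surjective (hf.surjective hr hMf)
  refine ⟨_, N, _, f, ?_, hf.mem, hf.rightPerp hr.ext h, h⟩
  obtain ⟨n, i, r, hir⟩ := addOf_iff.1 hM
  have hn := h₀.compLeft n
  choose α hα using fun j => hf₀.lift N hf.mem (LinearMap.proj j ∘ₗ i ∘ₗ f)
  have hα' : ∀ x, f₀.compLeft (Fin n) (LinearMap.pi α x) = i (f x) := fun x =>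
    funext fun j => LinearMap.congr_fun (hα j) x
  obtain ⟨β, hβ⟩ := hf.lift (ModuleCat.of R (Fin n → N₀)) (hX.pi n (fun _ => N₀) fun _ => hf₀.mem)
    (r ∘ₗ f₀.compLeft (Fin n))
  change (Fin n → N₀) →ₗ[R] N at β
  have hβ' : ∀ x, f (β x) = r (f₀.compLeft (Fin n) x) := LinearMap.congr_fun hβ
  -- Lifting the inclusion and retraction of `M` in `Bⁿ` gives `N → N₀ⁿ → N` over the identity of
  -- `M`. Minimality makes the composite invertible, so on kernels `ker f` is a summand of `(ker
  -- f₀)ⁿ`.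
  have hb := hf.minimal (β ∘ₗ LinearMap.pi α) (LinearMap.ext fun x => by
    rw [LinearMap.comp_apply, LinearMap.comp_apply, hβ', hα', hir])
  let φ := LinearEquiv.ofBijective (β ∘ₗ LinearMap.pi α) hb
  have hφ : ∀ x, f (φ.symm x) = f x := fun x => by
    conv_rhs => rw [← φ.apply_symm_apply x]
    rw [LinearEquiv.ofBijective_apply, LinearMap.comp_apply, hβ', hα', hir]
  obtain ⟨a, ha⟩ := hn.lift (T := ModuleCat.of R (LinearMap.ker f))
    (LinearMap.pi α ∘ₗ (LinearMap.ker f).subtype) (fun x => by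
    rw [LinearMap.comp_apply]
    exact (hα' _).trans (by rw [h.zero, map_zero]))
  obtain ⟨b, hb⟩ := h.lift (T := ModuleCat.of R (Fin n → LinearMap.ker f₀))
    (φ.symm.toLinearMap ∘ₗ β ∘ₗ (LinearMap.ker f₀).subtype.compLeft (Fin n)) (fun x => by
    rw [LinearMap.comp_apply, LinearEquiv.coe_coe, hφ, LinearMap.comp_apply, hβ']
    exact (congrArg r (hn.zero x)).trans (map_zero r))
  refine addOf_iff.2 ⟨n, a, b, fun x => h.1 ?_⟩
  refine (hb _).trans ?_
  rw [LinearMap.comp_apply, LinearMap.comp_apply]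
  refine (congrArg (fun y => φ.symm (β y)) (ha x)).trans ?_
  exact φ.symm_apply_apply _

/-- Relative cosyzygies of the modules in `add B`. -/
theorem exists_lTrans_addOf (hI : EnoughFiniteInjectives R) (hH : HomFinite R)
    (hX : IsSubcategory X) (hr : IsCoresolving X) (hA : X A) (hXA : ∀ M, X M → addOf A M)
    {B : ModuleCat.{u} R} (hB : Module.Finite R B) :
    ∃ B' : ModuleCat.{u} R, Module.Finite R B' ∧ LTrans X (addOf B) (addOf B') := by
  obtain ⟨N₀, f₀, hf₀⟩ := exists_isMinLeftApprox hH hX hA hXA hB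
  have h₀ := IsShortExact.of_injective (hf₀.injective hI hr hB)
  refine ⟨_, h₀.finite_right (hX.finite _ hf₀.mem), fun M hM => ?_⟩
  have hMf := (isSubcategory_addOf hB).finite M hM
  obtain ⟨N, f, hf⟩ := exists_isMinLeftApprox hH hX hA hXA hMf
  have h := IsShortExact.of_injective (hf.injective hI hr hMf)
  refine ⟨N, _, f, _, hf.mem, ?_, hf.leftPerp hr.ext h, h⟩
  obtain ⟨n, i, r, hir⟩ := addOf_iff.1 hM
  have hn := h₀.compLeft n
  choose β hβ using fun j => hf₀.desc N hf.mem (f ∘ₗ r ∘ₗ LinearMap.single R (fun _ => B) j)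
  have hβ' : ∀ x, LinearMap.lsum R (fun _ => N₀) ℕ β (f₀.compLeft (Fin n) x) = f (r x) := by
    intro x
    have : ∀ j, β j (f₀ (x j)) = f (r (Pi.single j (x j))) := fun j =>
      LinearMap.congr_fun (hβ j) (x j)
    simp only [LinearMap.lsum_apply, LinearMap.sum_apply, LinearMap.comp_apply,
      LinearMap.proj_apply, LinearMap.compLeft_apply, Function.comp_apply, this]
    rw [← map_sum, ← map_sum, Finset.univ_sum_single]
  obtain ⟨α, hα⟩ := hf.desc (ModuleCat.of R (Fin n → N₀)) (hX.pi n (fun _ => N₀) fun _ => hf₀.mem)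
    (f₀.compLeft (Fin n) ∘ₗ i)
  change N →ₗ[R] (Fin n → N₀) at α
  have hα' : ∀ x, α (f x) = f₀.compLeft (Fin n) (i x) := LinearMap.congr_fun hα
  set β' : (Fin n → N₀) →ₗ[R] N := LinearMap.lsum R (fun _ => N₀) ℕ β
  -- As in the dual case, `N → N₀ⁿ → N` is invertible by minimality, so the cokernel of `f` is a
  -- summand of the n-th power of the cokernel of `f₀`.
  have hb := hf.minimal (β' ∘ₗ α) (LinearMap.ext fun x => by
    rw [LinearMap.comp_apply, LinearMap.comp_apply, hα', hβ', hir])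
  let φ := LinearEquiv.ofBijective (β' ∘ₗ α) hb
  have hφ : ∀ x, φ.symm (f x) = f x := fun x => by
    rw [LinearEquiv.symm_apply_eq, LinearEquiv.ofBijective_apply, LinearMap.comp_apply, hα', hβ',
      hir]
  obtain ⟨a, ha⟩ := h.desc (T := ModuleCat.of R (Fin n → N₀ ⧸ LinearMap.range f₀))
    ((LinearMap.range f₀).mkQ.compLeft (Fin n) ∘ₗ α) (fun x => by
    rw [LinearMap.comp_apply, hα']
    exact hn.zero (i x))
  obtain ⟨b, hb⟩ := hn.desc (T := ModuleCat.of R (N ⧸ LinearMap.range f))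
    ((LinearMap.range f).mkQ ∘ₗ φ.symm.toLinearMap ∘ₗ β') (fun x => by
    rw [LinearMap.comp_apply, LinearMap.comp_apply]
    refine (congrArg (fun y => (LinearMap.range f).mkQ (φ.symm y)) (hβ' x)).trans ?_
    rw [hφ]
    exact h.zero (r x))
  refine addOf_iff.2 ⟨n, a, b, fun x => ?_⟩
  obtain ⟨y, rfl⟩ := h.2.2 x
  refine (congrArg b (ha y)).trans ((hb (α y)).trans ?_)
  exact congrArg (LinearMap.range f).mkQ (φ.symm_apply_apply y)

end

end ExtDimension

namespace ExtDimension

/-! ### Finitely generated injective modules over artin algebras -/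

section

variable (k : Type u) [CommRing k] [IsArtinianRing k]

/-- Induction on the length of `M` through left exactness of Hom. A nonzero map from a simple module
to `Q` lands in the essential submodule `σ(S)`, so Hom(T, S) → Hom(T, Q) is onto for T simple. -/
theorem isNoetherian_hom_of_essential {S Q : Type u} [AddCommGroup S] [Module k S]
    [AddCommGroup Q] [Module k Q] [Module.Finite k S] {σ : S →ₗ[k] Q}
    (hσ : Function.Injective σ)
    (hess : ∀ N : Submodule k Q, Disjoint N (LinearMap.range σ) → N = ⊥) {M : Type u}
    [AddCommGroup M] [Module k M] (hM : IsFiniteLength k M) : IsNoetherian k (M →ₗ[k] Q) := by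
  induction hM with
  | @of_subsingleton M _ _ _ =>
    have : Subsingleton (M →ₗ[k] Q) :=
      ⟨fun f g => LinearMap.ext fun x => by rw [Subsingleton.elim x 0, map_zero, map_zero]⟩
    infer_instance
  | @of_simple_quotient M _ _ N hs hN ih =>
    have : IsNoetherian k ((M ⧸ N) →ₗ[k] Q) := by
      refine isNoetherian_of_surjective (M := (M ⧸ N) →ₗ[k] S) (LinearMap.llcomp k (M ⧸ N) S Q σ)
        ?_
      refine LinearMap.range_eq_top.2 fun f => ?_
      by_cases hf : f = 0
      · exact ⟨0, by rw [map_zero, hf]⟩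
      have hr : ∀ x, f x ∈ LinearMap.range σ := by
        have h1 : (LinearMap.range σ).comap f ≠ ⊥ := fun h => by
          refine hf (LinearMap.range_eq_bot.1 (hess _ ?_))
          rw [disjoint_iff, eq_bot_iff]
          rintro _ ⟨⟨x, rfl⟩, hx⟩
          have : x ∈ (LinearMap.range σ).comap f := hx
          rw [h, Submodule.mem_bot] at this
          rw [this, map_zero]
          exact Submodule.zero_mem _
        have h2 := (eq_bot_or_eq_top _).resolve_left h1
        exact fun x => (h2 ▸ Submodule.mem_top : x ∈ (LinearMap.range σ).comap f)
      refine ⟨(LinearEquiv.ofInjective σ hσ).symm.toLinearMap ∘ₗ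
        f.codRestrict (LinearMap.range σ) hr, LinearMap.ext fun x => ?_⟩
      have := (LinearEquiv.ofInjective σ hσ).apply_symm_apply
        (f.codRestrict (LinearMap.range σ) hr x)
      exact congrArg Subtype.val this
    refine isNoetherian_of_range_eq_ker (LinearMap.lcomp k Q N.mkQ) (LinearMap.lcomp k Q N.subtype)
      ?_
    refine le_antisymm ?_ fun f hf => ?_
    · rintro _ ⟨g, rfl⟩
      refine LinearMap.ext fun x => ?_
      exact (congrArg g ((Submodule.Quotient.mk_eq_zero N).2 x.2)).trans (map_zero g)
    · have hf' : N ≤ LinearMap.ker f := fun x hx => LinearMap.congr_fun hf ⟨x, hx⟩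
      exact ⟨N.liftQ f hf', LinearMap.ext fun x => N.liftQ_apply (h := hf') f x⟩

/-- `E` is an injective hull of S = k/rad k, built as I/C with I injective containing S and C
maximal among submodules meeting S in zero. It is finitely generated because Q = Hom(k, Q) and k has
finite length. -/
theorem exists_finite_injective_cogenerator_comm :
    ∃ E : ModuleCat.{u} k, Module.Finite k E ∧ Module.Injective k E ∧
      ∀ T : ModuleCat.{u} k, IsSimpleModule k T → ∃ f : T →ₗ[k] E, Function.Injective f := by
  let S := k ⧸ Module.jacobson k k
  have hS : IsSemisimpleModule k S :=
    (IsArtinian.isSemisimpleModule_iff_jacobson k _).2 (Module.jacobson_quotient_jacobson k k)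
  obtain ⟨pres⟩ := CategoryTheory.EnoughInjectives.presentation (ModuleCat.of k S)
  let I := pres.J
  let ι : S →ₗ[k] I := pres.f.hom
  have hι : Function.Injective ι := (ModuleCat.mono_iff_injective pres.f).1 pres.mono
  have := pres.injective
  have hI : Module.Injective k I := Module.injective_module_of_injective_object k I
  obtain ⟨C, -, hC⟩ := zorn_le_nonempty₀ {C : Submodule k I | Disjoint (LinearMap.range ι) C}
    (fun c hc hch y hy => ⟨sSup c, (hch.directedOn.disjoint_sSup_right).2 fun b hb => hc hb,
      fun z hz => le_sSup hz⟩) ⊥ disjoint_bot_right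
  have hCd : Disjoint (LinearMap.range ι) C := hC.prop
  let Q := I ⧸ C
  let σ : S →ₗ[k] Q := C.mkQ ∘ₗ ι
  have hσ : Function.Injective σ := by
    refine (injective_iff_map_eq_zero _).2 fun s hs => ?_
    have h1 : ι s ∈ C := (Submodule.Quotient.mk_eq_zero C).1 hs
    exact hι ((Submodule.disjoint_def.1 hCd _ ⟨s, rfl⟩ h1).trans (map_zero ι).symm)
  have hess : ∀ N : Submodule k Q, Disjoint N (LinearMap.range σ) → N = ⊥ := by
    intro N hN
    have hle : C ≤ N.comap C.mkQ := fun x hx => by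
      rw [Submodule.mem_comap, show C.mkQ x = 0 from (Submodule.Quotient.mk_eq_zero C).2 hx]
      exact N.zero_mem
    have h1 : Disjoint (LinearMap.range ι) (N.comap C.mkQ) := by
      refine Submodule.disjoint_def.2 ?_
      rintro _ ⟨s, rfl⟩ hs
      have : σ s = 0 := Submodule.disjoint_def.1 hN _ hs ⟨s, rfl⟩
      rw [hσ (this.trans (map_zero σ).symm), map_zero]
    have h2 := hC.le_of_ge h1 hle
    refine eq_bot_iff.2 fun q hq => ?_
    obtain ⟨x, rfl⟩ := C.mkQ_surjective q
    exact (Submodule.Quotient.mk_eq_zero C).2 (h2 hq)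
  obtain ⟨ψ, hψ⟩ := hI.out σ hσ ι
  have hfin : IsNoetherian k (k →ₗ[k] Q) := isNoetherian_hom_of_essential k hσ hess
    (isFiniteLength_iff_isNoetherian_isArtinian.2 ⟨inferInstance, inferInstance⟩)
  have hQ : Module.Finite k Q := Module.Finite.equiv (LinearMap.ringLmapEquivSelf k k Q)
  -- This endomorphism of `Q` is the identity on `σ(S)`, so its kernel is zero by essentiality. As
  -- `Q` is artinian it is bijective, which makes `Q` a retract of the injective module `I`.
  have hinj : Function.Injective (C.mkQ ∘ₗ ψ) := by
    rw [← LinearMap.ker_eq_bot]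
    refine hess _ (Submodule.disjoint_def.2 ?_)
    rintro _ hs ⟨s, rfl⟩
    have h1 : ι s ∈ C := hψ s ▸ (Submodule.Quotient.mk_eq_zero C).1 hs
    rw [hι ((Submodule.disjoint_def.1 hCd _ ⟨s, rfl⟩ h1).trans (map_zero ι).symm), map_zero]
  let φ := LinearEquiv.ofBijective _ (IsArtinian.bijective_of_injective_endomorphism _ hinj)
  refine ⟨ModuleCat.of k Q, hQ, ⟨fun X Y _ _ _ _ f hf g => ?_⟩, fun T hT => ?_⟩
  · obtain ⟨h, hh⟩ := hI.out f hf (ψ ∘ₗ g)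
    refine ⟨φ.symm.toLinearMap ∘ₗ C.mkQ ∘ₗ h, fun x => ?_⟩
    rw [LinearMap.comp_apply, LinearMap.comp_apply, hh]
    exact φ.symm_apply_apply (g x)
  · have := hT.nontrivial
    obtain ⟨t, ht⟩ := exists_ne (0 : T)
    have h0 : LinearMap.toSpanSingleton k T t ≠ 0 := fun h => ht (by
      simpa using LinearMap.congr_fun h 1)
    have hs := LinearMap.surjective_of_ne_zero h0
    let p : S →ₗ[k] T := (Module.jacobson k k).liftQ (LinearMap.toSpanSingleton k T t)
      (IsSemisimpleModule.jacobson_le_ker k k k T _)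
    have hp : Function.Surjective p := fun y => by
      obtain ⟨x, rfl⟩ := hs y
      exact ⟨(Module.jacobson k k).mkQ x, Submodule.liftQ_apply _ _ _⟩
    -- `T` is a quotient of the semisimple module `S`, hence embeds in `S` and so in `Q`.
    obtain ⟨s, hs⟩ := IsSemisimpleModule.lifting_property p hp LinearMap.id
    exact ⟨σ ∘ₗ s, hσ.comp (Function.LeftInverse.injective (g := p) (LinearMap.congr_fun hs))⟩

end

/-! ### Coinduced modules, finiteness of Hom and the injective cogenerator of mod R. -/

/-- The left `R`-module `Hom_k(R, E)`. -/
def Coinduced (k R E : Type*) [CommRing k] [Ring R] [Algebra k R] [AddCommGroup E] [Module k E] :=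
  R →ₗ[k] E

namespace Coinduced

variable (k R E : Type*) [CommRing k] [Ring R] [Algebra k R] [AddCommGroup E] [Module k E]

instance : AddCommGroup (Coinduced k R E) := inferInstanceAs (AddCommGroup (R →ₗ[k] E))

instance : Module R (Coinduced k R E) where
  smul r f := LinearMap.comp f (LinearMap.mulRight k r)
  one_smul f := LinearMap.ext fun x => congrArg (DFunLike.coe (F := R →ₗ[k] E) f) (mul_one x)
  mul_smul r s f := LinearMap.ext fun x =>
    congrArg (DFunLike.coe (F := R →ₗ[k] E) f) (mul_assoc x r s).symm
  smul_zero _ := LinearMap.ext fun _ => rfl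
  smul_add _ _ _ := LinearMap.ext fun _ => rfl
  add_smul r s f := LinearMap.ext fun x =>
    (congrArg (DFunLike.coe (F := R →ₗ[k] E) f) (mul_add x r s)).trans (LinearMap.map_add f _ _)
  zero_smul f := LinearMap.ext fun x =>
    (congrArg (DFunLike.coe (F := R →ₗ[k] E) f) (mul_zero x)).trans (LinearMap.map_zero f)

variable {k R E}

/-- The evaluation of an element of `Hom_k(R, E)`. -/
def eval (f : Coinduced k R E) : R →ₗ[k] E := f

theorem eval_injective : Function.Injective (eval : Coinduced k R E → R →ₗ[k] E) := fun _ _ h => h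

theorem eval_add (f g : Coinduced k R E) : eval (f + g) = eval f + eval g := rfl

theorem eval_smul (r : R) (f : Coinduced k R E) (x : R) : eval (r • f) x = eval f (x * r) := rfl

instance [IsNoetherianRing k] [Module.Finite k R] [Module.Finite k E] :
    Module.Finite R (Coinduced k R E) := by
  obtain ⟨n, s, hs⟩ := Module.Finite.exists_fin (R := k) (M := R →ₗ[k] E)
  let s' : Fin n → Coinduced k R E := s
  refine Module.finite_def.2 (Submodule.fg_iff_exists_fin_generating_family.2 ⟨n, s', ?_⟩)
  refine eq_top_iff.2 fun f _ => ?_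
  have hf : eval f ∈ Submodule.span k (Set.range s) := by
    rw [hs]
    exact Submodule.mem_top
  suffices ∀ g ∈ Submodule.span k (Set.range s),
      (g : Coinduced k R E) ∈ Submodule.span R (Set.range s') from this _ hf
  intro g hg
  induction hg using Submodule.span_induction with
  | mem g hg =>
    obtain ⟨j, rfl⟩ := hg
    exact Submodule.subset_span ⟨j, rfl⟩
  | zero => exact Submodule.zero_mem _
  | add g h _ _ hg hh => exact Submodule.add_mem _ hg hh
  | smul c g _ hg =>
    let g' : Coinduced k R E := g
    -- `k` acts on values and `R` on arguments; the actions agree on `k` because its image in `R` is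
    -- central. Thus generators over `k` are generators over `R`.
    have : (c • g : R →ₗ[k] E) = eval (algebraMap k R c • g') :=
      LinearMap.ext fun x => by
        rw [eval_smul, ← Algebra.commutes, ← Algebra.smul_def, map_smul]
        rfl
    rw [this]
    exact Submodule.smul_mem _ _ hg

variable {M : Type*} [AddCommGroup M] [Module R M] [Module k M] [IsScalarTower k R M]

variable (R) in
/-- The adjoint of a `k`-linear map `M → E`. -/
def adjoint (φ : M →ₗ[k] E) : M →ₗ[R] Coinduced k R E where
  toFun m := φ ∘ₗ (LinearMap.toSpanSingleton R M m).restrictScalars k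
  map_add' m n := LinearMap.ext fun r => by
    refine Eq.trans ?_ (map_add φ _ _)
    simp
  map_smul' s m := LinearMap.ext fun r => congrArg φ (mul_smul r s m).symm

theorem eval_adjoint (φ : M →ₗ[k] E) (m : M) (r : R) : eval (adjoint R φ m) r = φ (r • m) := rfl

end Coinduced

section

variable (k : Type u) {R : Type u} [CommRing k] [Ring R] [Algebra k R]

/-- By the adjunction Hom_R(X, Hom_k(R, E)) = Hom_k(X, E): extend the `k`-linear map x ↦ g(x)(1) and
take its adjoint. -/
theorem Coinduced.injective {E : Type u} [AddCommGroup E] [Module k E] (hE : Module.Injective k E) :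
    Module.Injective R (Coinduced k R E) where
  out X Y _ _ _ _ f hf g := by
    let _ : Module k X := Module.compHom X (algebraMap k R)
    let _ : Module k Y := Module.compHom Y (algebraMap k R)
    have : IsScalarTower k R X := ⟨fun a b x => by rw [Algebra.smul_def, mul_smul]; rfl⟩
    have : IsScalarTower k R Y := ⟨fun a b x => by rw [Algebra.smul_def, mul_smul]; rfl⟩
    obtain ⟨h, hh⟩ := hE.out (f.restrictScalars k) hf
      { toFun := fun x => Coinduced.eval (g x) 1
        map_add' := fun x y => by rw [map_add, Coinduced.eval_add, LinearMap.add_apply]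
        map_smul' := fun c x => by
          rw [← algebraMap_smul R c x, map_smul, Coinduced.eval_smul, one_mul,
            Algebra.algebraMap_eq_smul_one, map_smul, RingHom.id_apply] }
    refine ⟨Coinduced.adjoint R h, fun x => Coinduced.eval_injective (LinearMap.ext fun r => ?_)⟩
    rw [Coinduced.eval_adjoint, ← map_smul]
    refine (hh (r • x)).trans ?_
    change Coinduced.eval (g (r • x)) 1 = _
    rw [map_smul, Coinduced.eval_smul, one_mul]

end

/-- Hom(A, M) embeds in a power of `M`, so it is finitely generated over `k`, and scalars of `k` act
through End A as well as through End M. -/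
theorem homFinite (k : Type u) {R : Type u} [CommRing k] [Ring R] [Algebra k R] [IsArtinianRing k]
    [Module.Finite k R] : HomFinite R := by
  intro A M hA hM
  let _ : Module k A := Module.compHom A (algebraMap k R)
  let _ : Module k M := Module.compHom M (algebraMap k R)
  have : IsScalarTower k R A := ⟨fun a b x => by rw [Algebra.smul_def, mul_smul]; rfl⟩
  have : IsScalarTower k R M := ⟨fun a b x => by rw [Algebra.smul_def, mul_smul]; rfl⟩
  have : SMulCommClass R k A := IsScalarTower.to_smulCommClass'
  have : SMulCommClass R k M := IsScalarTower.to_smulCommClass'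
  have : Module.Finite k M := Module.Finite.trans R M
  obtain ⟨n, q, hq⟩ := Module.Finite.exists_fin' R A
  have hf : Module.Finite k (A →ₗ[R] M) := by
    let ev : (A →ₗ[R] M) →ₗ[k] (Fin n → M) :=
      { toFun := fun h j => h (q (Pi.single j 1))
        map_add' := fun _ _ => rfl
        map_smul' := fun _ _ => rfl }
    refine Module.Finite.of_injective ev fun h h' hh => ?_
    have h1 : h ∘ₗ q = h' ∘ₗ q := LinearMap.pi_ext' fun j => LinearMap.ext_ring (congrFun hh j)
    refine LinearMap.ext fun a => ?_
    obtain ⟨x, rfl⟩ := hq a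
    exact LinearMap.congr_fun h1 x
  obtain ⟨m, g, hg⟩ := Module.Finite.exists_fin (R := k) (M := A →ₗ[R] M)
  have hc : ∀ h : A →ₗ[R] M, ∃ c : Fin m → k, ∑ j, c j • g j = h := fun h =>
    (Submodule.mem_span_range_iff_exists_fun k).1 (hg ▸ Submodule.mem_top)
  refine ⟨m, g, fun h => ?_, fun h => ?_⟩
  · obtain ⟨c, rfl⟩ := hc h
    refine ⟨fun j => c j • LinearMap.id, fun x => ?_⟩
    simp [LinearMap.sum_apply, LinearMap.map_smul_of_tower]
  · obtain ⟨c, rfl⟩ := hc h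
    exact ⟨fun j => c j • LinearMap.id, fun x => by simp [LinearMap.sum_apply]⟩

/-- `J` is an injective module of `mod R` and every module of `mod R` embeds in a power of `J`. -/
structure IsInjectiveCogenerator {R : Type u} [Ring R] (J : ModuleCat.{u} R) : Prop where
  finite : Module.Finite R J
  injective : Module.Injective R J
  embeds : ∀ M : ModuleCat.{u} R, Module.Finite R M →
    ∃ (n : ℕ) (f : M →ₗ[R] (Fin n → J)), Function.Injective f

theorem exists_isInjectiveCogenerator (k : Type u) {R : Type u} [CommRing k] [Ring R] [Algebra k R]
    [IsArtinianRing k] [Module.Finite k R] : ∃ J : ModuleCat.{u} R, IsInjectiveCogenerator J := by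
  obtain ⟨E, hEf, hEi, hE⟩ := exists_finite_injective_cogenerator_comm k
  refine ⟨ModuleCat.of R (Coinduced k R E), inferInstanceAs (Module.Finite R (Coinduced k R E)),
    Coinduced.injective k hEi, fun M hM => ?_⟩
  have : IsArtinianRing R := IsArtinianRing.of_finite k R
  let _ : Module k M := Module.compHom M (algebraMap k R)
  have : IsScalarTower k R M := ⟨fun a b x => by rw [Algebra.smul_def, mul_smul]; rfl⟩
  -- The cyclic module `k x` has a simple quotient, which embeds in `E`; the resulting map `k x → E`
  -- extends to `M` by injectivity, and its adjoint does not kill `x`.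
  have key : ∀ x : M, x ≠ 0 → ∃ f : M →ₗ[R] Coinduced k R E, f x ≠ 0 := by
    intro x hx
    let P := Submodule.span k {x}
    let x' : P := ⟨x, Submodule.mem_span_singleton_self x⟩
    have : Nontrivial P := ⟨x', 0, fun h => hx (congrArg Subtype.val h)⟩
    obtain ⟨m, hm, -⟩ := (eq_top_or_exists_le_coatom (⊥ : Submodule k P)).resolve_left bot_ne_top
    have hs : IsSimpleModule k (P ⧸ m) := isSimpleModule_iff_isCoatom.2 hm
    obtain ⟨e, he⟩ := hE (ModuleCat.of k (P ⧸ m)) hs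
    obtain ⟨φ, hφ⟩ := hEi.out P.subtype P.injective_subtype (e ∘ₗ m.mkQ)
    refine ⟨Coinduced.adjoint R φ, fun h => hm.1 ?_⟩
    have h1 : φ x = 0 := by
      rw [← one_smul R x, ← Coinduced.eval_adjoint, h]
      rfl
    have h2 : m.mkQ x' = 0 := he (by
      rw [map_zero]
      exact (hφ x').symm.trans h1)
    refine eq_top_iff.2 ?_
    rintro ⟨y, hy⟩ -
    obtain ⟨c, rfl⟩ := Submodule.mem_span_singleton.1 hy
    exact m.smul_mem c (by simpa using h2)
  -- Choose a map to a finite power with minimal kernel. A nonzero element of the kernel would allow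
  -- one more coordinate and a smaller kernel.
  obtain ⟨K, ⟨n, f, rfl⟩, hK⟩ := IsArtinian.set_has_minimal
    {K : Submodule R M | ∃ (n : ℕ) (f : M →ₗ[R] (Fin n → Coinduced k R E)), K = LinearMap.ker f}
    ⟨_, 0, 0, rfl⟩
  refine ⟨n, f, LinearMap.ker_eq_bot.1 ?_⟩
  by_contra hne
  obtain ⟨x, hx, hx0⟩ := Submodule.exists_mem_ne_zero_of_ne_bot hne
  obtain ⟨g, hg⟩ := key x hx0
  refine hK _ ⟨n + 1, (Fin.consLinearEquiv R fun _ => Coinduced k R E).toLinearMap ∘ₗ g.prod f, rfl⟩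
    (lt_of_le_of_ne (fun y hy => ?_) fun h => hg ?_)
  · exact congrArg Prod.snd ((LinearEquiv.map_eq_zero_iff
      (Fin.consLinearEquiv R fun _ => Coinduced k R E)).1 hy)
  · rw [← h] at hx
    exact congrArg Prod.fst ((LinearEquiv.map_eq_zero_iff
      (Fin.consLinearEquiv R fun _ => Coinduced k R E)).1 hx)

end ExtDimension

namespace ExtDimension

variable {R : Type u} [Ring R]

/-! ### Injective and projective modules as subcategories -/

theorem injective_of_addOf {J M : ModuleCat.{u} R} (hJ : Module.Injective R J) (hM : addOf J M) :
    Module.Injective R M where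
  out Y Z _ _ _ _ f hf g := by
    obtain ⟨n, i, r, hr⟩ := addOf_iff.1 hM
    choose h hh using fun j => hJ.out f hf (LinearMap.proj j ∘ₗ i ∘ₗ g)
    refine ⟨r ∘ₗ LinearMap.pi h, fun x => ?_⟩
    rw [LinearMap.comp_apply, ← hr (g x)]
    exact congrArg r (funext fun j => hh j x)

theorem IsInjectiveCogenerator.enoughFiniteInjectives {J : ModuleCat.{u} R}
    (hJ : IsInjectiveCogenerator J) : EnoughFiniteInjectives R := fun M hM => by
  obtain ⟨n, f, hf⟩ := hJ.embeds M hM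
  have := hJ.finite
  refine ⟨ModuleCat.of R (Fin n → J), f, inferInstanceAs (Module.Finite R (Fin n → J)),
    injective_of_addOf hJ.injective ?_, hf⟩
  exact addOf_iff.2 ⟨n, LinearMap.id, LinearMap.id, fun x => rfl⟩

theorem IsInjectiveCogenerator.isCoresolving {J : ModuleCat.{u} R}
    (hJ : IsInjectiveCogenerator J) : IsCoresolving (addOf J) where
  injective M hM hi := by
    obtain ⟨n, f, hf⟩ := hJ.embeds M hM
    obtain ⟨r, hr⟩ := hi.out f hf LinearMap.id
    exact addOf_iff.2 ⟨n, f, r, hr⟩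
  ext A B C f g h hA hC := by
    obtain ⟨r, hr⟩ := (injective_of_addOf hJ.injective hA).out f h.1 LinearMap.id
    obtain ⟨s, hs⟩ := h.exists_section hr
    obtain ⟨e⟩ := h.nonempty_equiv_prod hs
    exact isoClosed_addOf J (ModuleCat.of R (A × C)) B e.symm (addOf_prod hA hC)
  coker A B C f g h hA hB := by
    obtain ⟨r, hr⟩ := (injective_of_addOf hJ.injective hA).out f h.1 LinearMap.id
    obtain ⟨s, hs⟩ := h.exists_section hr
    exact addClosure_summand s g (LinearMap.ext hs) hB

variable (R) in
/-- The regular module. -/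
abbrev regular : ModuleCat.{u} R := ModuleCat.of R R

theorem projective_of_addOf_regular {M : ModuleCat.{u} R} (hM : addOf (regular R) M) :
    Module.Projective R M := by
  obtain ⟨n, i, r, hr⟩ := addOf_iff.1 hM
  exact Module.Projective.of_split i r (LinearMap.ext hr)

theorem isResolving_addOf_regular : IsResolving (addOf (regular R)) where
  projective M hM hp := by
    obtain ⟨n, q, hq⟩ := Module.Finite.exists_fin' R M
    obtain ⟨s, hs⟩ := Module.projective_lifting_property q LinearMap.id hq
    exact addOf_iff.2 ⟨n, s, q, LinearMap.congr_fun hs⟩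
  ext A B C f g h hA hC := by
    have := projective_of_addOf_regular hC
    obtain ⟨s, hs⟩ := Module.projective_lifting_property g LinearMap.id h.2.2
    obtain ⟨e⟩ := h.nonempty_equiv_prod (LinearMap.congr_fun hs)
    exact isoClosed_addOf _ (ModuleCat.of R (A × C)) B e.symm (addOf_prod hA hC)
  ker A B C f g h hB hC := by
    have := projective_of_addOf_regular hC
    obtain ⟨s, hs⟩ := Module.projective_lifting_property g LinearMap.id h.2.2
    obtain ⟨r, hr⟩ := h.exists_retraction (LinearMap.congr_fun hs)
    exact addClosure_summand f r (LinearMap.ext hr) hB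

/-! ### Bounding extension powers along relative (co)syzygies -/

section

variable [IsArtinianRing R]

/-- Undoes one relative syzygy at the cost of one more extension, up to an injective summand. The
module `A'` is chosen before `q` and the sequence, which is what makes the final bound uniform in
`M`. -/
theorem exists_starPow_of_kernel (hH : HomFinite R) {J : ModuleCat.{u} R}
    (hJ : IsInjectiveCogenerator J) {A₀ A : ModuleCat.{u} R} (hA₀ : Module.Finite R A₀)
    (hA : Module.Finite R A) :
    ∃ A' : ModuleCat.{u} R, Module.Finite R A' ∧ ∀ (q : ℕ) (K N M : ModuleCat.{u} R)
      (i : K →ₗ[R] N) (f : N →ₗ[R] M), IsShortExact i f → addOf A₀ N →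
      (∃ I : ModuleCat.{u} R, addOf J I ∧ starPow (addOf A) q (ModuleCat.of R (K × I))) →
      ∃ I : ModuleCat.{u} R, addOf J I ∧ starPow (addOf A') (q + 1) (ModuleCat.of R (M × I)) := by
  have hI := hJ.enoughFiniteInjectives
  have hXJ := isSubcategory_addOf hJ.finite
  obtain ⟨A₁, hA₁, ht⟩ := exists_lTrans_addOf hI hH hXJ hJ.isCoresolving (addOf_self J)
    (fun _ h => h) hA
  have := hJ.finite
  let A₂ := ModuleCat.of R (A₀ × J)
  have hA₂ : Module.Finite R A₂ := inferInstanceAs (Module.Finite R (A₀ × J))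
  have hA' : Module.Finite R (ModuleCat.of R (A₂ × A₁)) := inferInstanceAs (Module.Finite R (A₂ × A₁))
  refine ⟨ModuleCat.of R (A₂ × A₁), hA', ?_⟩
  rintro q K N M i f h hN ⟨I, hIJ, hK⟩
  -- Ordinary cosyzygies: the dual horseshoe lemma for the coresolving class add J.
  obtain ⟨I', C, m, c, hI', hC, -, hmc⟩ := ht.starPow hI hXJ hJ.isCoresolving q _ hK
  have hN' : IsShortExact (A := ModuleCat.of R (K × I)) (B := ModuleCat.of R (N × I))
      (i.prodMap LinearMap.id) (f ∘ₗ LinearMap.fst R N I) :=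
    .mk' (h.1.prodMap Function.injective_id) (fun a => h.zero _) (fun b hb => by
      obtain ⟨a, ha⟩ := h.exact hb
      exact ⟨(a, b.2), Prod.ext ha rfl⟩) (h.2.2.comp LinearMap.fst_surjective)
  -- `E` is the pushout of N ⊕ I and I' over K ⊕ I. One side, 0 → I' → E → M → 0, splits since I' is
  -- injective; the other is 0 → N ⊕ I → E → C → 0.
  obtain ⟨E, u, v, w, hE, huv, -, hs, hk, hd⟩ := hN'.exists_pushout m
  obtain ⟨r, hr⟩ := (injective_of_addOf hJ.injective hI').out u hE.1 LinearMap.id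
  obtain ⟨s, hs'⟩ := hE.exists_section hr
  obtain ⟨e⟩ := hE.nonempty_equiv_prod hs'
  obtain ⟨c', hcu, hcv⟩ := hd C c 0 (fun a => by rw [hmc.zero, LinearMap.zero_apply])
  have hvc : IsShortExact v c' := by
    refine .mk' ((injective_iff_map_eq_zero _).2 fun b hb => ?_) hcv (fun x hx => ?_) (fun y => ?_)
    · obtain ⟨a, ha, rfl⟩ := hk 0 b (by rw [hb, map_zero])
      rw [hmc.1 (ha.trans (map_zero m).symm), map_zero]
    · obtain ⟨d, b, rfl⟩ := hs x
      rw [map_add, hcu, hcv, LinearMap.zero_apply, add_zero] at hx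
      obtain ⟨a, rfl⟩ := hmc.exact hx
      exact ⟨i.prodMap LinearMap.id a + b, by rw [map_add, huv]⟩
    · obtain ⟨d, rfl⟩ := hmc.2.2 y
      exact ⟨u d, hcu d⟩
  refine ⟨I', hI', IsoClosed.starPow _ (q + 1) E _ (e.trans (LinearEquiv.prodComm R I' M)) ?_⟩
  refine ⟨_, C, v, c', addOf_trans hA' (addOf_fst A₂ A₁) _ (addOf_prod
    (addOf_trans hA₂ (addOf_fst A₀ J) _ hN) (addOf_trans hA₂ (addOf_snd A₀ J) _ hIJ)), ?_, hvc⟩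
  exact starPow_mono (addOf_trans hA' (addOf_snd A₂ A₁)) q _ hC

/-- Dual step: cover K ⊕ P by a projective P' with kernel C and pull back. The pullback is M ⊕ P'
because P' is projective, and it is an extension of N ⊕ P by C. The new factor comes on the right,
whence `starPow_star`. -/
theorem exists_starPow_of_cokernel (hH : HomFinite R) {A₀ A : ModuleCat.{u} R}
    (hA₀ : Module.Finite R A₀) (hA : Module.Finite R A) :
    ∃ A' : ModuleCat.{u} R, Module.Finite R A' ∧ ∀ (q : ℕ) (M N K : ModuleCat.{u} R)
      (i : M →ₗ[R] N) (f : N →ₗ[R] K), IsShortExact i f → addOf A₀ N →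
      (∃ P, addOf (regular R) P ∧ starPow (addOf A) q (ModuleCat.of R (K × P))) →
      ∃ P, addOf (regular R) P ∧ starPow (addOf A') (q + 1) (ModuleCat.of R (M × P)) := by
  have hRf : Module.Finite R (regular R) := inferInstanceAs (Module.Finite R R)
  have hXR := isSubcategory_addOf hRf
  obtain ⟨A₁, hA₁, ht⟩ := exists_rTrans_addOf hH hXR isResolving_addOf_regular
    (addOf_self (regular R)) (fun _ h => h) hA
  let A₂ := ModuleCat.of R (A₀ × regular R)
  have hA₂ : Module.Finite R A₂ := inferInstanceAs (Module.Finite R (A₀ × R))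
  have hA' : Module.Finite R (ModuleCat.of R (A₂ × A₁)) := inferInstanceAs (Module.Finite R (A₂ × A₁))
  refine ⟨ModuleCat.of R (A₂ × A₁), hA', ?_⟩
  rintro q M N K i f h hN ⟨P, hP, hK⟩
  obtain ⟨C, P', m, c, hC, hP', -, hmc⟩ := ht.starPow hXR isResolving_addOf_regular q _ hK
  have hN' : IsShortExact (B := ModuleCat.of R (N × P)) (C := ModuleCat.of R (K × P))
      (LinearMap.inl R N P ∘ₗ i) (f.prodMap LinearMap.id) :=
    .mk' (LinearMap.inl_injective.comp h.1) (fun a => Prod.ext (h.zero a) rfl) (fun b hb => by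
      obtain ⟨a, ha⟩ := h.exact (congrArg Prod.fst hb)
      exact ⟨a, Prod.ext ha (congrArg Prod.snd hb).symm⟩) (h.2.2.prodMap Function.surjective_id)
  obtain ⟨E, u, v, w, hE, hvw, -, hinj, hk, hd⟩ := hN'.exists_pullback c
  have := projective_of_addOf_regular hP'
  obtain ⟨s, hs⟩ := Module.projective_lifting_property w LinearMap.id hE.2.2
  obtain ⟨e⟩ := hE.nonempty_equiv_prod (LinearMap.congr_fun hs)
  obtain ⟨c', hcv, hcw⟩ := hd C 0 m (fun a => by rw [hmc.zero, LinearMap.zero_apply, map_zero])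
  have hvc : IsShortExact c' v := by
    refine .mk' (fun a b hab => hmc.1 (by rw [← hcw, hab, hcw])) hcv (fun x hx => ?_) (fun y => ?_)
    · obtain ⟨d, hd⟩ := hmc.exact (b := w x) (by rw [← hvw, hx, map_zero])
      refine ⟨d, sub_eq_zero.1 (hinj _ ?_ ?_)⟩
      · rw [map_sub, hcv, hx, LinearMap.zero_apply, sub_zero]
      · rw [map_sub, hcw, hd, sub_self]
    · obtain ⟨d, hd⟩ := hmc.2.2 (f.prodMap LinearMap.id y)
      obtain ⟨x, hx, -⟩ := hk y d hd.symm
      exact ⟨x, hx⟩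
  refine ⟨P', hP', IsoClosed.starPow _ (q + 1) E _ e ?_⟩
  refine starPow_star (isoClosed_addOf _) q _ ⟨C, _, c', v, ?_, addOf_trans hA' (addOf_fst A₂ A₁) _
    (addOf_prod (addOf_trans hA₂ (addOf_fst A₀ (regular R)) _ hN)
      (addOf_trans hA₂ (addOf_snd A₀ (regular R)) _ hP)), hvc⟩
  exact starPow_mono (addOf_trans hA' (addOf_snd A₂ A₁)) q _ hC

/-- Each cover lowers `m` by one and replaces `add B` by relative syzygies. The case `m = 0` needs
one further cover to turn the 𝓧-layers into zero, which accounts for the `+ 1` in the exponent. -/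
theorem exists_starPow_of_layered_resDim (hH : HomFinite R) {J : ModuleCat.{u} R}
    (hJ : IsInjectiveCogenerator J) {X : ModuleCat.{u} R → Prop} (hX : IsSubcategory X)
    (hr : IsResolving X) {A₀ : ModuleCat.{u} R} (hA₀ : X A₀) (hXA : ∀ M, X M → addOf A₀ M)
    (n m : ℕ) : ∀ {B : ModuleCat.{u} R}, Module.Finite R B →
    ∃ A : ModuleCat.{u} R, Module.Finite R A ∧ ∀ M, layered (resDim X m) (addOf B) n M →
      ∃ I : ModuleCat.{u} R, addOf J I ∧ starPow (addOf A) (m + n + 1) (ModuleCat.of R (M × I)) := by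
  induction m with
  | zero =>
    intro B hB
    obtain ⟨B', hB', hBB⟩ := exists_rTrans_addOf hH hX hr hA₀ hXA hB
    obtain ⟨A, hA, hs⟩ := exists_starPow_of_kernel hH hJ (hX.finite _ hA₀) hB'
    refine ⟨A, hA, fun M hM => ?_⟩
    obtain ⟨K, N, i, f, hK, hN, -, h⟩ := (RTrans.zeroClass X).layered hX hr hBB n M hM
    rw [zero_add]
    have hZ : Subsingleton (ModuleCat.of R PUnit.{u + 1}) := inferInstanceAs (Subsingleton PUnit)
    refine hs n K N M i f h (hXA N hN) ⟨ModuleCat.of R PUnit, addOf_zero J hZ, ?_⟩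
    exact IsoClosed.starPow _ n K _ (LinearEquiv.prodUnique (R := R) (M₂ := PUnit.{u + 1})).symm
      (layered_zeroClass (isoClosed_addOf _) n K hK)
  | succ m ih =>
    intro B hB
    obtain ⟨B', hB', hBB⟩ := exists_rTrans_addOf hH hX hr hA₀ hXA hB
    obtain ⟨A, hA, hAB⟩ := ih hB'
    obtain ⟨A', hA', hs⟩ := exists_starPow_of_kernel hH hJ (hX.finite _ hA₀) hA
    refine ⟨A', hA', fun M hM => ?_⟩
    obtain ⟨K, N, i, f, hK, hN, -, h⟩ :=
      RTrans.layered (W := resDim X (m + 1)) (W' := resDim X m) hX hr (fun M h => h) hBB n M hM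
    obtain ⟨I, hI, hKI⟩ := hAB K hK
    have := hs (m + n + 1) K N M i f h (hXA N hN) ⟨I, hI, hKI⟩
    rwa [Nat.add_right_comm m 1 n]

theorem exists_starPow_of_layered_coresDim (hI : EnoughFiniteInjectives R) (hH : HomFinite R)
    {X : ModuleCat.{u} R → Prop} (hX : IsSubcategory X)
    (hr : IsCoresolving X) {A₀ : ModuleCat.{u} R} (hA₀ : X A₀) (hXA : ∀ M, X M → addOf A₀ M)
    (n m : ℕ) : ∀ {B : ModuleCat.{u} R}, Module.Finite R B →
    ∃ A : ModuleCat.{u} R, Module.Finite R A ∧ ∀ M, layered (coresDim X m) (addOf B) n M →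
      ∃ P, addOf (regular R) P ∧ starPow (addOf A) (m + n + 1) (ModuleCat.of R (M × P)) := by
  induction m with
  | zero =>
    intro B hB
    obtain ⟨B', hB', hBB⟩ := exists_lTrans_addOf hI hH hX hr hA₀ hXA hB
    obtain ⟨A, hA, hs⟩ := exists_starPow_of_cokernel hH (hX.finite _ hA₀) hB'
    refine ⟨A, hA, fun M hM => ?_⟩
    obtain ⟨N, K, i, f, hN, hK, -, h⟩ := (LTrans.zeroClass X).layered hI hX hr hBB n M hM
    rw [zero_add]
    have hZ : Subsingleton (ModuleCat.of R PUnit.{u + 1}) := inferInstanceAs (Subsingleton PUnit)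
    refine hs n M N K i f h (hXA N hN) ⟨ModuleCat.of R PUnit, addOf_zero _ hZ, ?_⟩
    exact IsoClosed.starPow _ n K _ (LinearEquiv.prodUnique (R := R) (M₂ := PUnit.{u + 1})).symm
      (layered_zeroClass (isoClosed_addOf _) n K hK)
  | succ m ih =>
    intro B hB
    obtain ⟨B', hB', hBB⟩ := exists_lTrans_addOf hI hH hX hr hA₀ hXA hB
    obtain ⟨A, hA, hAB⟩ := ih hB'
    obtain ⟨A', hA', hs⟩ := exists_starPow_of_cokernel hH (hX.finite _ hA₀) hA
    refine ⟨A', hA', fun M hM => ?_⟩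
    obtain ⟨N, K, i, f, hN, hK, -, h⟩ :=
      LTrans.layered (W := coresDim X (m + 1)) (W' := coresDim X m) hI hX hr (fun M h => h) hBB n
        M hM
    have := hs (m + n + 1) M N K i f h (hXA N hN) (hAB K hK)
    rwa [Nat.add_right_comm m 1 n]

/-! ### Subcategories of finite type -/

theorem exists_addOf_of_isOfFiniteType {X : ModuleCat.{u} R → Prop} (hX : IsSubcategory X)
    (hf : IsOfFiniteType X) : ∃ A, X A ∧ ∀ M, X M → addOf A M := by
  classical
  obtain ⟨n, Y, hY⟩ := hf
  -- The listed modules need not lie in 𝓧; those outside are replaced by zero so that the product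
  -- does.
  let Z : Fin n → ModuleCat.{u} R := fun j => if X (Y j) then Y j else ModuleCat.of R PUnit
  have hZ : ∀ j, X (Z j) := fun j => by
    by_cases h : X (Y j)
    · simpa only [Z, if_pos h] using h
    · simpa only [Z, if_neg h] using hX.zero _ (inferInstanceAs (Subsingleton PUnit))
  let A := ModuleCat.of R (∀ j, Z j)
  have hA : X A := hX.pi n Z hZ
  refine ⟨A, hA, ?_⟩
  suffices ∀ (ℓ : ℕ∞) (M : ModuleCat.{u} R), Module.length R M = ℓ → X M → addOf A M from
    fun M hM => this _ M rfl hM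
  intro ℓ
  induction ℓ using WellFoundedLT.induction with
  | ind ℓ ih =>
    intro M hℓ hM
    have hMf := hX.finite M hM
    by_cases hs : Subsingleton M
    · exact addOf_zero A hs
    by_cases hind : IsIndecomposable M
    · obtain ⟨j, ⟨e⟩⟩ := hY M hM hind
      have hYX : X (Y j) := hX.isoClosed _ _ e hM
      have hZY : Z j = Y j := if_pos hYX
      refine isoClosed_addOf A (Z j) M (hZY ▸ e.symm) ?_
      exact addClosure_summand (N := A) (LinearMap.single R (fun j => Z j) j) (LinearMap.proj j)
        (LinearMap.proj_comp_single_same R (fun j => Z j) j) (addOf_self A)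
    · rw [IsIndecomposable, not_and] at hind
      have h2 := hind (not_subsingleton_iff_nontrivial.1 hs)
      push Not at h2
      obtain ⟨P, Q, hPQ, hP, hQ⟩ := h2
      have hPt : P ≠ ⊤ := fun h => hQ (by simpa [h] using hPQ.inf_eq_bot)
      have hQt : Q ≠ ⊤ := fun h => hP (by simpa [h] using hPQ.inf_eq_bot)
      exact isoClosed_addOf A (ModuleCat.of R (P × Q)) M (Submodule.prodEquivOfIsCompl P Q hPQ)
        (addOf_prod
          (ih _ (hℓ ▸ Submodule.length_lt hPt) (ModuleCat.of R P) rfl (hX.submodule hM hPQ))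
          (ih _ (hℓ ▸ Submodule.length_lt hQt) (ModuleCat.of R Q) rfl (hX.submodule hM hPQ.symm)))

end

/-! ### Extension powers and the extension dimension -/

theorem extPower_of_starPow (A : ModuleCat.{u} R) (n : ℕ) :
    ∀ M, starPow (addOf A) n M → extPower (isoClass A) n M := by
  induction n with
  | zero => exact fun M h => h
  | succ n ih =>
    cases n with
    | zero => exact fun M h => star_zeroClass (isoClosed_addOf A) h
    | succ n => exact fun M h => subset_addClosure (star_mono (fun _ => id) ih M h)

theorem extPower_summand (A : ModuleCat.{u} R) (n : ℕ) {M N : ModuleCat.{u} R} (i : M →ₗ[R] N)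
    (r : N →ₗ[R] M) (h : r ∘ₗ i = LinearMap.id) (hN : extPower (isoClass A) (n + 1) N) :
    extPower (isoClass A) (n + 1) M := by
  cases n with
  | zero => exact addClosure_summand i r h hN
  | succ n =>
    unfold extPower bullet at hN ⊢
    exact addClosure_summand i r h hN

theorem finite_of_addClosure {U : ModuleCat.{u} R → Prop} (hU : ∀ M, U M → Module.Finite R M)
    (M : ModuleCat.{u} R) (hM : addClosure U M) : Module.Finite R M := by
  obtain ⟨n, Y, hY, i, r, h⟩ := hM
  have := fun j => hU _ (hY j)
  exact Module.Finite.of_surjective r fun x => ⟨i x, LinearMap.congr_fun h x⟩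

theorem finite_of_extPower {A : ModuleCat.{u} R} (hA : Module.Finite R A) (n : ℕ) :
    ∀ M, extPower (isoClass A) n M → Module.Finite R M := by
  induction n with
  | zero =>
    intro M (h : Subsingleton M)
    infer_instance
  | succ n ih =>
    cases n with
    | zero => exact fun M h => (isSubcategory_addOf hA).finite M h
    | succ n =>
      intro M hM
      unfold extPower bullet at hM
      refine finite_of_addClosure ?_ M hM
      rintro M ⟨B, C, f, g, hB, hC, h⟩
      exact h.finite_middle ((isSubcategory_addOf hA).finite B hB) (ih C hC)

/-- A complement `N` is harmless because `extPower` is closed under direct summands, while `starPow`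
takes no summands of the middle terms. -/
theorem extDim_le {A : ModuleCat.{u} R} (hA : Module.Finite R A) (n : ℕ)
    (h : ∀ M : ModuleCat.{u} R, Module.Finite R M →
      ∃ N : ModuleCat.{u} R, starPow (addOf A) (n + 1) (ModuleCat.of R (M × N))) :
    extDim R ≤ ((n : ℝ) : EReal) := by
  refine iInf₂_le n ⟨A, hA, fun M => ⟨fun hM => ?_, finite_of_extPower hA _ M⟩⟩
  obtain ⟨N, hN⟩ := h M hM
  exact extPower_summand A n (N := ModuleCat.of R (M × N)) (LinearMap.inl R M N)
    (LinearMap.fst R M N) (by ext; simp) (extPower_of_starPow A _ _ hN)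

/-! ### Torsion-free modules and the layers of a module -/

/-- No subquotient of `M` is a simple module outside `𝓥`. -/
def IsTorsionFree (V : Set (ModuleCat.{u} R)) (M : ModuleCat.{u} R) : Prop :=
  ∀ (U : Submodule R M) (S : ModuleCat.{u} R), simpleCompl V S → ∀ f : U →ₗ[R] S, f = 0

variable {V : Set (ModuleCat.{u} R)}

/-- This is what the formulation by subquotients is for: the torsion-free class of a general torsion
pair is not closed under quotients. -/
theorem IsTorsionFree.of_surjective {M N : ModuleCat.{u} R} (hM : IsTorsionFree V M)
    {φ : M →ₗ[R] N} (hφ : Function.Surjective φ) : IsTorsionFree V N := by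
  intro U S hS f
  have h := hM (U.comap φ) S hS (f ∘ₗ φ.restrict fun x hx => hx)
  refine LinearMap.ext ?_
  rintro ⟨y, hy⟩
  obtain ⟨x, rfl⟩ := hφ y
  exact LinearMap.congr_fun h ⟨x, hy⟩

theorem IsTorsionFree.prod {M N : ModuleCat.{u} R} (hM : IsTorsionFree V M)
    (hN : IsTorsionFree V N) : IsTorsionFree V (ModuleCat.of R (M × N)) := by
  intro U S hS f
  change Submodule R (M × N) at U
  change U →ₗ[R] S at f
  have h1 := hM (U.comap (LinearMap.inl R M N)) S hS
    (f ∘ₗ (LinearMap.inl R M N).restrict fun x hx => hx)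
  let p : U →ₗ[R] U.map (LinearMap.snd R M N) :=
    (LinearMap.snd R M N).restrict fun x hx => ⟨x, hx, rfl⟩
  have hp : Function.Surjective p := by
    rintro ⟨_, x, hx, rfl⟩
    exact ⟨⟨x, hx⟩, rfl⟩
  obtain ⟨t, ht⟩ := exists_factor_of_surjective (A := ModuleCat.of R U)
    (B := ModuleCat.of R (U.map (LinearMap.snd R M N))) (g := p) hp f (by
      rintro ⟨⟨a, b⟩, hx⟩ h
      obtain rfl : b = 0 := congrArg Subtype.val h
      exact LinearMap.congr_fun h1 ⟨a, hx⟩)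
  have h2 := hN _ S hS t
  refine LinearMap.ext fun x => ?_
  rw [← ht, h2]
  rfl

theorem IsTorsionFree.pi {M : ModuleCat.{u} R} (hM : IsTorsionFree V M) (n : ℕ) :
    IsTorsionFree V (ModuleCat.of R (Fin n → M)) := by
  induction n with
  | zero =>
    intro U S _ f
    refine LinearMap.ext fun x => ?_
    have : x = 0 := Subtype.ext (Subsingleton.elim (α := Fin 0 → M) _ _)
    rw [this, map_zero, map_zero]
  | succ n ih =>
    exact (hM.prod ih).of_surjective (N := ModuleCat.of R (Fin (n + 1) → M))
      (φ := (Fin.consLinearEquiv R fun _ => M).toLinearMap) (LinearEquiv.surjective _)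

/-- Common core of the arguments for t and rad. The image N' of Pⁿ lies in Q by functoriality, and
N/N' is a quotient of (M/P)ⁿ, which `hQ` turns into Q ≤ N'. -/
theorem exists_surjective_restrict {M N : ModuleCat.{u} R} {n : ℕ} {φ : (Fin n → M) →ₗ[R] N}
    (hφ : Function.Surjective φ) (P : Submodule R M) (Q : Submodule R N)
    (hPQ : ∀ f : M →ₗ[R] N, ∀ x ∈ P, f x ∈ Q)
    (hQ : ∀ N' : Submodule R N, (∃ t : (Fin n → M ⧸ P) →ₗ[R] N ⧸ N', Function.Surjective t) →
      Q ≤ N') :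
    ∃ ψ : (Fin n → P) →ₗ[R] Q, Function.Surjective ψ := by
  have hmem : ∀ x : Fin n → P, φ (P.subtype.compLeft (Fin n) x) ∈ Q := by
    intro x
    rw [← Finset.univ_sum_single (P.subtype.compLeft (Fin n) x), map_sum]
    exact Q.sum_mem fun j _ => hPQ (φ ∘ₗ LinearMap.single R (fun _ => M) j) _ (x j).2
  have h := hQ (LinearMap.range (φ ∘ₗ P.subtype.compLeft (Fin n))) (by
    obtain ⟨t, ht⟩ := exists_factor_of_surjective (A := ModuleCat.of R (Fin n → M))
      (B := ModuleCat.of R (Fin n → M ⧸ P)) (g := P.mkQ.compLeft (Fin n))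
      (C := ModuleCat.of R (N ⧸ LinearMap.range (φ ∘ₗ P.subtype.compLeft (Fin n))))
      (P.mkQ_surjective.comp_left) (Submodule.mkQ _ ∘ₗ φ) (by
        intro x hx
        refine (Submodule.Quotient.mk_eq_zero _).2
          ⟨fun j => ⟨x j, (Submodule.Quotient.mk_eq_zero P).1 (congrFun hx j)⟩, rfl⟩)
    refine ⟨t, Function.Surjective.of_comp (g := P.mkQ.compLeft (Fin n)) ?_⟩
    have h1 : ⇑t ∘ ⇑(P.mkQ.compLeft (Fin n)) = ⇑(Submodule.mkQ _ ∘ₗ φ) := funext ht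
    have h2 := (Submodule.mkQ_surjective
      (LinearMap.range (φ ∘ₗ P.subtype.compLeft (Fin n)))).comp hφ
    exact h1 ▸ h2)
  refine ⟨(φ ∘ₗ P.subtype.compLeft (Fin n)).codRestrict Q hmem, ?_⟩
  rintro ⟨y, hy⟩
  obtain ⟨x, rfl⟩ := h hy
  exact ⟨x, rfl⟩

section

variable [IsArtinianRing R]

/-- Given a nonzero map f : U → S with S simple outside 𝓥, a submodule W minimal with f ≠ 0 on W is
torsion: for a nonzero map g from W to S' in 𝓥, f vanishes on ker g, so f factors through S' and S'
≅ S. -/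
theorem isTorsionFree_of (hV : ∀ S ∈ V, IsSimpleModule R S) {M : ModuleCat.{u} R}
    (hM : Module.Finite R M)
    (h : ∀ N : Submodule R M, torsionClass V (ModuleCat.of R N) → N = ⊥) : IsTorsionFree V M := by
  intro U S hS f
  by_contra hf
  have hne : ∃ x : U, f x ≠ 0 := by
    by_contra! h0
    exact hf (LinearMap.ext h0)
  obtain ⟨x₀, hx₀⟩ := hne
  obtain ⟨W, ⟨hWU, x, hx⟩, hmin⟩ := IsArtinian.set_has_minimal
    {W : Submodule R M | ∃ (hWU : W ≤ U), ∃ x : W, f (Submodule.inclusion hWU x) ≠ 0}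
    ⟨U, le_rfl, x₀, hx₀⟩
  have hW : torsionClass V (ModuleCat.of R W) := by
    refine (torsionClass_iff hV _).2 ⟨inferInstanceAs (Module.Finite R W), fun S' hS' g => ?_⟩
    change W →ₗ[R] S' at g
    by_contra hg
    have := hV S' hS'
    have hgs := LinearMap.surjective_of_ne_zero hg
    have hker : ∀ w : W, g w = 0 → f (Submodule.inclusion hWU w) = 0 := by
      intro w hw
      by_contra hfw
      have hle : (LinearMap.ker g).map W.subtype ≤ W := Submodule.map_subtype_le _ _
      refine hmin ((LinearMap.ker g).map W.subtype)
        ⟨hle.trans hWU, ⟨w, Submodule.mem_map_of_mem hw⟩, hfw⟩ (lt_of_le_of_ne hle fun he => hg ?_)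
      refine LinearMap.ext fun y => ?_
      obtain ⟨z, hz, hzy⟩ := show (y : M) ∈ (LinearMap.ker g).map W.subtype by
        rw [he]
        exact y.2
      rw [← Subtype.ext hzy]
      exact hz
    obtain ⟨t, ht⟩ := exists_factor_of_surjective (A := ModuleCat.of R W) (g := g) hgs
      (f ∘ₗ Submodule.inclusion hWU) hker
    have := hS.1
    rcases LinearMap.bijective_or_eq_zero t with hb | h0
    · exact (hS.2 S' hS').false (LinearEquiv.ofBijective t hb).symm
    · refine hx ?_
      have := ht x
      rw [h0] at this
      exact this.symm
  refine hx ?_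
  have : x = 0 := Subtype.ext (by simpa [h W hW] using x.2)
  rw [this, map_zero, map_zero]

/-- A nonzero image would have a simple quotient. It is not in 𝓥, being a quotient of `T`, and it is
not outside 𝓥, being a subquotient of `N`. -/
theorem IsTorsionFree.eq_zero (hV : ∀ S ∈ V, IsSimpleModule R S) {T N : ModuleCat.{u} R}
    (hT : torsionClass V T) (hN : IsTorsionFree V N) (f : T →ₗ[R] N) : f = 0 := by
  obtain ⟨hTf, hT⟩ := (torsionClass_iff hV T).1 hT
  by_contra hf
  have hfin : Module.Finite R (LinearMap.range f) := inferInstance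
  have hnt : Nontrivial (LinearMap.range f) :=
    (Submodule.nontrivial_iff_ne_bot).2 fun h => hf (LinearMap.range_eq_bot.1 h)
  obtain ⟨m, hm, -⟩ :=
    (eq_top_or_exists_le_coatom (⊥ : Submodule R (LinearMap.range f))).resolve_left bot_ne_top
  have hs : IsSimpleModule R (LinearMap.range f ⧸ m) := isSimpleModule_iff_isCoatom.2 hm
  have h0 : m.mkQ = 0 := hN (LinearMap.range f) (ModuleCat.of R (LinearMap.range f ⧸ m))
    ⟨hs, fun S' hS' => ⟨fun e => by
      have h := hT S' hS' (e.toLinearMap ∘ₗ m.mkQ ∘ₗ f.rangeRestrict)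
      have := hs.nontrivial
      obtain ⟨y, hy⟩ := exists_ne (0 : LinearMap.range f ⧸ m)
      obtain ⟨⟨_, x, rfl⟩, rfl⟩ := m.mkQ_surjective y
      exact hy ((LinearEquiv.map_eq_zero_iff e).1 (LinearMap.congr_fun h x))⟩⟩ m.mkQ
  refine hm.1 ?_
  rw [← m.ker_mkQ, h0, LinearMap.ker_zero]

theorem torsionClass_of_isShortExact (hV : ∀ S ∈ V, IsSimpleModule R S) {A B C : ModuleCat.{u} R}
    {f : A →ₗ[R] B} {g : B →ₗ[R] C} (h : IsShortExact f g) (hA : torsionClass V A)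
    (hC : torsionClass V C) : torsionClass V B := by
  refine (torsionClass_iff hV B).2 ⟨h.finite_middle hA.1 hC.1, fun S hS t => ?_⟩
  obtain ⟨s, hs⟩ := h.desc t
    (LinearMap.congr_fun (((torsionClass_iff hV A).1 hA).2 S hS (t ∘ₗ f)))
  have := ((torsionClass_iff hV C).1 hC).2 S hS s
  refine LinearMap.ext fun x => ?_
  rw [← hs, this]
  rfl

theorem isTorsionFree_quotient (hV : ∀ S ∈ V, IsSimpleModule R S) (M : ModuleCat.{u} R)
    (hM : Module.Finite R M) : IsTorsionFree V (ModuleCat.of R (M ⧸ torsionSubmodule V M)) := by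
  refine isTorsionFree_of hV (inferInstanceAs (Module.Finite R (M ⧸ torsionSubmodule V M)))
    fun (N : Submodule R (M ⧸ torsionSubmodule V M)) hN => ?_
  let t := torsionSubmodule V M
  have hle : t ≤ N.comap t.mkQ := fun x hx => by
    rw [Submodule.mem_comap, show t.mkQ x = 0 from (Submodule.Quotient.mk_eq_zero t).2 hx]
    exact N.zero_mem
  have hs : IsShortExact (A := ModuleCat.of R t) (B := ModuleCat.of R (N.comap t.mkQ))
      (C := ModuleCat.of R N) (Submodule.inclusion hle) (t.mkQ.restrict fun x hx => hx) := by
    refine .mk' (Submodule.inclusion_injective hle)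
      (fun a => Subtype.ext ((Submodule.Quotient.mk_eq_zero t).2 a.2)) (fun b hb => ?_) ?_
    · exact ⟨⟨b, (Submodule.Quotient.mk_eq_zero t).1 (congrArg Subtype.val hb)⟩, rfl⟩
    · rintro ⟨y, hy⟩
      obtain ⟨x, rfl⟩ := t.mkQ_surjective y
      exact ⟨⟨x, hy⟩, rfl⟩
  have h : N.comap t.mkQ ≤ t :=
    le_sSup (torsionClass_of_isShortExact hV hs (torsionRadical_mem hV M) hN)
  refine eq_bot_iff.2 fun y hy => ?_
  obtain ⟨x, rfl⟩ := t.mkQ_surjective y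
  exact (Submodule.Quotient.mk_eq_zero t).2 (h hy)

theorem exists_surjective_torsionRadical (hV : ∀ S ∈ V, IsSimpleModule R S)
    {M N : ModuleCat.{u} R} (hM : Module.Finite R M) (hN : Module.Finite R N) {n : ℕ}
    {φ : (Fin n → M) →ₗ[R] N} (hφ : Function.Surjective φ) :
    ∃ ψ : (Fin n → torsionRadical V M) →ₗ[R] torsionRadical V N, Function.Surjective ψ := by
  refine exists_surjective_restrict hφ _ _ (fun f x hx => ?_) ?_
  · have := IsTorsionFree.eq_zero hV (torsionRadical_mem hV M) (isTorsionFree_quotient hV N hN)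
      ((torsionSubmodule V N).mkQ ∘ₗ f ∘ₗ (torsionSubmodule V M).subtype)
    exact (Submodule.Quotient.mk_eq_zero _).1 (LinearMap.congr_fun this ⟨x, hx⟩)
  · rintro N' ⟨t, ht⟩ x hx
    have htf : IsTorsionFree V (ModuleCat.of R (N ⧸ N')) :=
      ((isTorsionFree_quotient hV M hM).pi n).of_surjective (φ := t) ht
    have := htf.eq_zero hV (torsionRadical_mem hV N) (N'.mkQ ∘ₗ (torsionSubmodule V N).subtype)
    exact (Submodule.Quotient.mk_eq_zero _).1 (LinearMap.congr_fun this ⟨x, hx⟩)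

theorem isSemisimpleModule_top (M : ModuleCat.{u} R) (hM : Module.Finite R M) :
    IsSemisimpleModule R (M ⧸ Module.jacobson R M) :=
  (IsArtinian.isSemisimpleModule_iff_jacobson R _).2 (Module.jacobson_quotient_jacobson R M)

theorem exists_surjective_radical {M N : ModuleCat.{u} R} (hM : Module.Finite R M) {n : ℕ}
    {φ : (Fin n → M) →ₗ[R] N} (hφ : Function.Surjective φ) :
    ∃ ψ : (Fin n → radical M) →ₗ[R] radical N, Function.Surjective ψ := by
  refine exists_surjective_restrict hφ _ _ (fun f x hx => Module.le_comap_jacobson f hx) ?_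
  rintro N' ⟨t, ht⟩
  have := isSemisimpleModule_top M hM
  have : IsSemisimpleModule R (N ⧸ N') := IsSemisimpleModule.of_surjective t ht
  exact Module.jacobson_le_of_eq_bot (IsSemisimpleModule.jacobson_eq_bot R _)

theorem exists_surjective_iterate (hV : ∀ S ∈ V, IsSimpleModule R S) (i n : ℕ) :
    ∀ {M N : ModuleCat.{u} R}, Module.Finite R M → Module.Finite R N →
    ∀ {φ : (Fin n → M) →ₗ[R] N}, Function.Surjective φ →
    ∃ ψ : (Fin n → torsionRadical V ((fun L => radical (torsionRadical V L))^[i] M)) →ₗ[R]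
      torsionRadical V ((fun L => radical (torsionRadical V L))^[i] N), Function.Surjective ψ := by
  induction i with
  | zero => exact fun hM hN _ hφ => exists_surjective_torsionRadical hV hM hN hφ
  | succ i ih =>
    intro M N hM hN φ hφ
    obtain ⟨ψ, hψ⟩ := exists_surjective_torsionRadical hV hM hN hφ
    have hM' : Module.Finite R (torsionRadical V M) :=
      inferInstanceAs (Module.Finite R (torsionSubmodule V M))
    have hN' : Module.Finite R (torsionRadical V N) :=
      inferInstanceAs (Module.Finite R (torsionSubmodule V N))
    obtain ⟨χ, hχ⟩ := exists_surjective_radical hM' hψ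
    exact ih (M := radical (torsionRadical V M)) (N := radical (torsionRadical V N))
      (inferInstanceAs (Module.Finite R (Module.jacobson R (torsionRadical V M))))
      (inferInstanceAs (Module.Finite R (Module.jacobson R (torsionRadical V N)))) hχ

/-- Layer lengths do not grow when passing from a generator to an arbitrary module. -/
theorem subsingleton_torsionRadical_iterate (hV : ∀ S ∈ V, IsSimpleModule R S) {i : ℕ}
    {G M : ModuleCat.{u} R} (hG : Module.Finite R G) (e : R ≃ₗ[R] G) (hM : Module.Finite R M)
    (h : Subsingleton (torsionRadical V ((fun L => radical (torsionRadical V L))^[i] G))) :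
    Subsingleton (torsionRadical V ((fun L => radical (torsionRadical V L))^[i] M)) := by
  obtain ⟨n, q, hq⟩ := Module.Finite.exists_fin' R M
  obtain ⟨ψ, hψ⟩ := exists_surjective_iterate hV i n hG hM
    (φ := q ∘ₗ e.symm.toLinearMap.compLeft (Fin n)) (hq.comp e.symm.surjective.comp_left)
  exact hψ.subsingleton

variable (R) in
/-- The top of the regular module. -/
noncomputable abbrev regularTop : ModuleCat.{u} R := top (regular R)

/-- The top of `M` is a quotient of a power of the semisimple module R/rad R, hence a summand of it.
-/
theorem addOf_regularTop (M : ModuleCat.{u} R) (hM : Module.Finite R M) :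
    addOf (regularTop R) (top M) := by
  obtain ⟨n, q, hq⟩ := Module.Finite.exists_fin' R M
  have h1 : ∀ x : Fin n → R, (∀ j, x j ∈ Module.jacobson R R) → q x ∈ Module.jacobson R M := by
    intro x hx
    rw [← Finset.univ_sum_single x, map_sum]
    exact Submodule.sum_mem _ fun j _ => Module.le_comap_jacobson
      (q ∘ₗ LinearMap.single R (fun _ => R) j) (hx j)
  obtain ⟨t, ht⟩ := exists_factor_of_surjective (A := ModuleCat.of R (Fin n → R))
    (B := ModuleCat.of R (Fin n → R ⧸ Module.jacobson R R)) (C := top M)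
    (g := (Module.jacobson R R).mkQ.compLeft (Fin n))
    (Submodule.mkQ_surjective _).comp_left ((Module.jacobson R M).mkQ ∘ₗ q) (fun x hx =>
      (Submodule.Quotient.mk_eq_zero _).2 (h1 x fun j =>
        (Submodule.Quotient.mk_eq_zero _).1 (congrFun hx j)))
  change (Fin n → R ⧸ Module.jacobson R R) →ₗ[R] (M ⧸ Module.jacobson R M) at t
  have hts : Function.Surjective t := fun y => by
    obtain ⟨m, rfl⟩ := Submodule.mkQ_surjective _ y
    obtain ⟨x, rfl⟩ := hq m
    exact ⟨_, ht x⟩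
  have : IsSemisimpleModule R (R ⧸ Module.jacobson R R) :=
    isSemisimpleModule_top (regular R) (inferInstanceAs (Module.Finite R R))
  obtain ⟨s, hs⟩ := IsSemisimpleModule.lifting_property t hts LinearMap.id
  exact addOf_iff.2 ⟨n, s, t, LinearMap.congr_fun hs⟩

/-- One round peels M ⊇ t(M) ⊇ rad t(M): the first factor is in 𝔉(𝓥), the second is the top of t(M).
When t vanishes, what is left is itself in 𝔉(𝓥). -/
theorem layered_of_subsingleton (hV : ∀ S ∈ V, IsSimpleModule R S) (i : ℕ) :
    ∀ (M : ModuleCat.{u} R), Module.Finite R M →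
    Subsingleton (torsionRadical V ((fun L => radical (torsionRadical V L))^[i] M)) →
    layered (filtClass V) (addOf (regularTop R)) i M := by
  induction i with
  | zero =>
    intro M hM h
    change Subsingleton (torsionSubmodule V M) at h
    refine filtClass_of hV M fun N hN => eq_bot_iff.2 ?_
    have h1 : N ≤ torsionSubmodule V M := le_sSup hN
    rwa [(Submodule.subsingleton_iff_eq_bot).1 h] at h1
  | succ i ih =>
    intro M hM h
    have hT : Module.Finite R (torsionRadical V M) :=
      inferInstanceAs (Module.Finite R (torsionSubmodule V M))
    have h1 := ih (radical (torsionRadical V M))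
      (inferInstanceAs (Module.Finite R (Module.jacobson R (torsionRadical V M)))) h
    have hs₁ : IsShortExact (A := radical (torsionRadical V M)) (C := top (torsionRadical V M))
        (Module.jacobson R (torsionRadical V M)).subtype
        (Module.jacobson R (torsionRadical V M)).mkQ :=
      .mk' Subtype.val_injective (fun a => (Submodule.Quotient.mk_eq_zero _).2 a.2)
        (fun b hb => ⟨⟨b, (Submodule.Quotient.mk_eq_zero _).1 hb⟩, rfl⟩) (Submodule.mkQ_surjective _)
    have hs₂ : IsShortExact (A := torsionRadical V M)
        (C := ModuleCat.of R (M ⧸ torsionSubmodule V M))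
        (torsionSubmodule V M).subtype (torsionSubmodule V M).mkQ :=
      .mk' Subtype.val_injective (fun a => (Submodule.Quotient.mk_eq_zero _).2 a.2)
        (fun b hb => ⟨⟨b, (Submodule.Quotient.mk_eq_zero _).1 hb⟩, rfl⟩) (Submodule.mkQ_surjective _)
    exact ⟨_, _, _, _, ⟨_, _, _, _, h1, addOf_regularTop _ hT, hs₁⟩,
      quotient_mem_filtClass hV M, hs₂⟩

end

theorem filtClass_le {D : ModuleCat.{u} R → Prop} (hiso : IsoClosed D)
    (h0 : ∀ M : ModuleCat.{u} R, Subsingleton M → D M) (hext : ∀ M, star D D M → D M)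
    (hVD : ∀ S ∈ V, D S) (M : ModuleCat.{u} R) (hM : filtClass V M) : D M := by
  obtain ⟨-, m, c, hc0, hcm, hc⟩ := hM
  have key : ∀ i ≤ m, D (ModuleCat.of R (c i)) := by
    intro i
    induction i with
    | zero =>
      intro _
      refine h0 _ ?_
      change Subsingleton (c 0)
      rw [hc0]
      infer_instance
    | succ i ih =>
      intro hi
      obtain ⟨hle, S, hS, ⟨e⟩⟩ := hc i hi
      refine hext _ ⟨ModuleCat.of R (c i),
        ModuleCat.of R (c (i + 1) ⧸ (c i).submoduleOf (c (i + 1))), Submodule.inclusion hle,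
        Submodule.mkQ _, ih (Nat.le_of_succ_le hi), hiso S _ e.symm (hVD S hS),
        .mk' (Submodule.inclusion_injective hle) (fun a => ?_) (fun b hb => ?_)
          (Submodule.mkQ_surjective _)⟩
      · exact (Submodule.Quotient.mk_eq_zero _).2 a.2
      · exact ⟨⟨b, (Submodule.Quotient.mk_eq_zero ((c i).submoduleOf (c (i + 1)))).1 hb⟩, rfl⟩
  exact hiso (ModuleCat.of R (c m)) M ((LinearEquiv.ofEq _ _ hcm).trans Submodule.topEquiv)
    (key m le_rfl)

/-! ### The bounds -/

theorem layerLength_eq (α β : ModuleCat.{u} R → ModuleCat.{u} R) (M : ModuleCat.{u} R) :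
    layerLength α β M = ⊤ ∨
      ∃ i : ℕ, Subsingleton (α (β^[i] M)) ∧ layerLength α β M = ((i : ℝ) : EReal) := by
  classical
  by_cases h : ∃ i : ℕ, Subsingleton (α (β^[i] M))
  · refine Or.inr ⟨Nat.find h, Nat.find_spec h, le_antisymm (iInf₂_le
      (f := fun (i : ℕ) (_ : Subsingleton (α (β^[i] M))) => ((i : ℝ) : EReal)) _ (Nat.find_spec h)) ?_⟩
    refine le_iInf₂ fun i hi => ?_
    exact_mod_cast Nat.find_min' h hi
  · push Not at h
    refine Or.inl (top_le_iff.1 (le_iInf₂ fun i hi => ?_))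
    exact absurd hi (not_subsingleton_iff_nontrivial.2 (h i))

/-- A finite supremum of infima of sets of naturals is bounded below by its floor p, and each
infimum, being less than p + 1, is witnessed by some n ≤ p. Nonemptiness keeps the supremum away
from ⊥. -/
theorem eq_top_or_exists_nat_bound {V : Set (ModuleCat.{u} R)} (hne : V.Nonempty)
    (d : ModuleCat.{u} R → EReal) (Z : ModuleCat.{u} R → Set ℕ)
    (hd : ∀ S ∈ V, d S = ⨅ n ∈ Z S, ((n : ℝ) : EReal)) :
    (⨆ S ∈ V, d S) = ⊤ ∨ ∃ p : ℕ, ((p : ℝ) : EReal) ≤ (⨆ S ∈ V, d S) ∧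
      ∀ S ∈ V, ∃ n ∈ Z S, n ≤ p := by
  by_cases htop : (⨆ S ∈ V, d S) = ⊤
  · exact Or.inl htop
  right
  have h0 : 0 ≤ ⨆ S ∈ V, d S := by
    obtain ⟨S, hS⟩ := hne
    refine le_trans ?_ (le_iSup₂ (f := fun S _ => d S) S hS)
    rw [hd S hS]
    refine le_iInf₂ fun n _ => ?_
    exact_mod_cast Nat.zero_le n
  lift (⨆ S ∈ V, d S) to ℝ using ⟨htop, (EReal.bot_lt_zero.trans_le h0).ne'⟩ with s hs
  have hs0 : 0 ≤ s := by exact_mod_cast h0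
  refine ⟨⌊s⌋₊, by exact_mod_cast Nat.floor_le hs0, fun S hS => ?_⟩
  have h1 : d S < (((⌊s⌋₊ + 1 : ℕ) : ℝ) : EReal) := by
    refine (le_iSup₂ (f := fun S _ => d S) S hS).trans_lt ?_
    rw [← hs]
    exact_mod_cast Nat.lt_floor_add_one s
  rw [hd S hS] at h1
  obtain ⟨n, hn⟩ := iInf_lt_iff.1 h1
  obtain ⟨hnZ, hn⟩ := iInf_lt_iff.1 hn
  refine ⟨n, hnZ, Nat.lt_succ_iff.1 ?_⟩
  exact_mod_cast hn

theorem relPdClass_eq {X : ModuleCat.{u} R → Prop} {V : Set (ModuleCat.{u} R)}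
    (hV : ∀ S ∈ V, IsSimpleModule R S) (hne : V.Nonempty) :
    relPdClass X V = ⊤ ∨ ∃ p : ℕ, ((p : ℝ) : EReal) ≤ relPdClass X V ∧
      ∀ S ∈ V, ∃ n ≤ p, ∃ K, IsSyzygy X n S K ∧ X K := by
  rw [relPdClass, if_neg hne.ne_empty]
  rcases eq_top_or_exists_nat_bound hne (relPd X) (fun S => {n | ∃ K, IsSyzygy X n S K ∧ X K})
    (fun S hS => by
      have := (hV S hS).nontrivial
      rw [relPd, if_neg (not_subsingleton S)]) with h | ⟨p, hp, h⟩
  · exact Or.inl h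
  · exact Or.inr ⟨p, hp, fun S hS => (h S hS).imp fun n hn => ⟨hn.2, hn.1⟩⟩

theorem relIdClass_eq {X : ModuleCat.{u} R → Prop} {V : Set (ModuleCat.{u} R)}
    (hV : ∀ S ∈ V, IsSimpleModule R S) (hne : V.Nonempty) :
    relIdClass X V = ⊤ ∨ ∃ p : ℕ, ((p : ℝ) : EReal) ≤ relIdClass X V ∧
      ∀ S ∈ V, ∃ n ≤ p, ∃ K, IsCosyzygy X n S K ∧ X K := by
  rw [relIdClass, if_neg hne.ne_empty]
  rcases eq_top_or_exists_nat_bound hne (relId X) (fun S => {n | ∃ K, IsCosyzygy X n S K ∧ X K})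
    (fun S hS => by
      have := (hV S hS).nontrivial
      rw [relId, if_neg (not_subsingleton S)]) with h | ⟨p, hp, h⟩
  · exact Or.inl h
  · exact Or.inr ⟨p, hp, fun S hS => (h S hS).imp fun n hn => ⟨hn.2, hn.1⟩⟩

theorem finite_of_mem {V : Set (ModuleCat.{u} R)} (hV : ∀ S ∈ V, IsSimpleModule R S) {S : ModuleCat.{u} R} (hS : S ∈ V) :
    Module.Finite R S :=
  have := hV S hS
  inferInstance

/-! ### Assembling the inequalities, including the degenerate values. -/

section

variable [IsArtinianRing R] {V : Set (ModuleCat.{u} R)}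

/-- The case `𝓥 = ∅`, where the layer length is the Loewy length. -/
theorem extDim_le_of_eq_empty [Nontrivial R] {G : ModuleCat.{u} R} (e : R ≃ₗ[R] G) {i : ℕ}
    (h : Subsingleton (torsionRadical (∅ : Set (ModuleCat.{u} R))
      ((fun L => radical (torsionRadical ∅ L))^[i] G))) :
    extDim R ≤ -1 + ((i : ℝ) : EReal) := by
  have hV : ∀ S ∈ (∅ : Set (ModuleCat.{u} R)), IsSimpleModule R S := fun S hS => hS.elim
  have hG : Module.Finite R G := Module.Finite.equiv e
  have hT : Module.Finite R (regularTop R) :=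
    inferInstanceAs (Module.Finite R (R ⧸ Module.jacobson R R))
  cases i with
  | zero =>
    -- For 𝓥 = ∅ every finitely generated module is torsion, so layer length zero would force the
    -- ring to be zero.
    have htop : (⊤ : Submodule R G) ≤ torsionSubmodule ∅ G :=
      le_sSup ((torsionClass_iff hV _).2
        ⟨inferInstanceAs (Module.Finite R (⊤ : Submodule R G)), fun S hS => hS.elim⟩)
    change Subsingleton (torsionSubmodule ∅ G) at h
    rw [Submodule.subsingleton_iff_eq_bot] at h
    rw [h, top_le_iff] at htop
    have : Subsingleton G := (Submodule.subsingleton_iff R).1 (subsingleton_of_bot_eq_top htop)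
    exact absurd e.injective.subsingleton (not_subsingleton R)
  | succ i =>
    have h1 : (-1 : EReal) + (((i + 1 : ℕ) : ℝ) : EReal) = ((i : ℝ) : EReal) := by
      rw [show (-1 : EReal) = ((-1 : ℝ) : EReal) from rfl, ← EReal.coe_add]
      congr 1
      push_cast
      ring
    rw [h1]
    refine extDim_le hT i fun M hM => ⟨ModuleCat.of R PUnit, ?_⟩
    refine IsoClosed.starPow _ (i + 1) M _
      (LinearEquiv.prodUnique (R := R) (M₂ := PUnit.{u + 1})).symm ?_
    refine layered_zeroClass (isoClosed_addOf _) (i + 1) M (layered_mono ?_ (i + 1) M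
      (layered_of_subsingleton hV (i + 1) M hM
        (subsingleton_torsionRadical_iterate hV hG e hM h)))
    refine filtClass_le IsoClosed.zeroClass (fun M hM => hM) (fun M hM => ?_) fun S hS => hS.elim
    exact zeroClass_star IsoClosed.zeroClass hM

theorem layered_of_filtClass_le (hV : ∀ S ∈ V, IsSimpleModule R S) {G : ModuleCat.{u} R}
    (e : R ≃ₗ[R] G) {i : ℕ}
    (h : Subsingleton (torsionRadical V ((fun L => radical (torsionRadical V L))^[i] G)))
    {D : ModuleCat.{u} R → Prop} (hD : ∀ M, filtClass V M → D M) (M : ModuleCat.{u} R)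
    (hM : Module.Finite R M) : layered D (addOf (regularTop R)) i M :=
  layered_mono hD i M (layered_of_subsingleton hV i M hM
    (subsingleton_torsionRadical_iterate hV (Module.Finite.equiv e) e hM h))

theorem extDim_le_of_isResolving (hH : HomFinite R) {J : ModuleCat.{u} R}
    (hJ : IsInjectiveCogenerator J) (hV : ∀ S ∈ V, IsSimpleModule R S)
    {X : ModuleCat.{u} R → Prop} (hX : IsSubcategory X) (hfin : IsOfFiniteType X)
    (hr : IsResolving X) {G : ModuleCat.{u} R} (e : R ≃ₗ[R] G) {i p : ℕ}
    (h : Subsingleton (torsionRadical V ((fun L => radical (torsionRadical V L))^[i] G)))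
    (hp : ∀ S ∈ V, ∃ n ≤ p, ∃ K, IsSyzygy X n S K ∧ X K) :
    extDim R ≤ (((p + i : ℕ) : ℝ) : EReal) := by
  obtain ⟨A₀, hA₀, hXA⟩ := exists_addOf_of_isOfFiniteType hX hfin
  obtain ⟨A, hA, hs⟩ := exists_starPow_of_layered_resDim hH hJ hX hr hA₀ hXA i p
    (B := regularTop R) (inferInstanceAs (Module.Finite R (R ⧸ Module.jacobson R R)))
  refine extDim_le hA (p + i) fun M hM => ?_
  suffices hD : ∀ N, filtClass V N → resDim X p N by
    obtain ⟨I, -, hI⟩ := hs M (layered_of_filtClass_le hV e h hD M hM)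
    exact ⟨I, hI⟩
  refine filtClass_le (resDim_isoClosed hX p)
    (fun M hM => resDim_le hX (Nat.zero_le p) M (hX.zero M hM)) (resDim_star hX hr p)
    fun S hS => ?_
  obtain ⟨n, hn, K, hK, hXK⟩ := hp S hS
  have := (resDim_of_isSyzygy hX hr (finite_of_mem hV hS) n K hK).2 0 hXK
  exact resDim_le hX hn S (by rwa [zero_add] at this)

theorem extDim_le_of_isCoresolving (hH : HomFinite R) (hI : EnoughFiniteInjectives R)
    (hV : ∀ S ∈ V, IsSimpleModule R S)
    {X : ModuleCat.{u} R → Prop} (hX : IsSubcategory X) (hfin : IsOfFiniteType X)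
    (hr : IsCoresolving X) {G : ModuleCat.{u} R} (e : R ≃ₗ[R] G) {i p : ℕ}
    (h : Subsingleton (torsionRadical V ((fun L => radical (torsionRadical V L))^[i] G)))
    (hp : ∀ S ∈ V, ∃ n ≤ p, ∃ K, IsCosyzygy X n S K ∧ X K) :
    extDim R ≤ (((p + i : ℕ) : ℝ) : EReal) := by
  obtain ⟨A₀, hA₀, hXA⟩ := exists_addOf_of_isOfFiniteType hX hfin
  obtain ⟨A, hA, hs⟩ := exists_starPow_of_layered_coresDim hI hH hX hr hA₀ hXA i p
    (B := regularTop R) (inferInstanceAs (Module.Finite R (R ⧸ Module.jacobson R R)))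
  refine extDim_le hA (p + i) fun M hM => ?_
  suffices hD : ∀ N, filtClass V N → coresDim X p N by
    obtain ⟨P, -, hP⟩ := hs M (layered_of_filtClass_le hV e h hD M hM)
    exact ⟨P, hP⟩
  refine filtClass_le (coresDim_isoClosed hX p)
    (fun M hM => coresDim_le hX (Nat.zero_le p) M (hX.zero M hM)) (coresDim_star hI hX hr p)
    fun S hS => ?_
  obtain ⟨n, hn, K, hK, hXK⟩ := hp S hS
  have := (coresDim_of_isCosyzygy hI hX hr (finite_of_mem hV hS) n K hK).2 0 hXK
  exact coresDim_le hX hn S (by rwa [zero_add] at this)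

/-- Bookkeeping in `EReal`, common to both parts. Since ⊥ absorbs ⊤ under addition, each infinite
case must check that the other summand is not ⊥. -/
theorem extDim_le_add [Nontrivial R] {G : ModuleCat.{u} R} (e : R ≃ₗ[R] G) {d : EReal}
    (hd : V = ∅ → d = -1)
    (hdV : V.Nonempty → d = ⊤ ∨ ∃ p : ℕ, ((p : ℝ) : EReal) ≤ d ∧ ∀ i : ℕ,
      Subsingleton (torsionRadical V ((fun L => radical (torsionRadical V L))^[i] G)) →
      extDim R ≤ (((p + i : ℕ) : ℝ) : EReal)) :
    extDim R ≤ d + radicalLayerLength (torsionRadical V) G := by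
  rcases V.eq_empty_or_nonempty with rfl | hne
  · rw [hd rfl]
    rcases layerLength_eq (torsionRadical ∅) (fun L => radical (torsionRadical ∅ L)) G with
      h | ⟨i, hi, h⟩
    · rw [radicalLayerLength, h, EReal.add_top_of_ne_bot (by decide)]
      exact le_top
    · rw [radicalLayerLength, h]
      exact extDim_le_of_eq_empty e hi
  · rcases layerLength_eq (torsionRadical V) (fun L => radical (torsionRadical V L)) G with
      h | ⟨i, hi, h⟩ <;> rcases hdV hne with rfl | ⟨p, hp, hpi⟩ <;> rw [radicalLayerLength, h]
    · simp
    · rw [EReal.add_top_of_ne_bot]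
      · exact le_top
      · exact ((EReal.bot_lt_coe _).trans_le hp).ne'
    · rw [EReal.top_add_of_ne_bot (EReal.coe_ne_bot _)]
      exact le_top
    · refine (hpi i hi).trans (le_trans (le_of_eq ?_) (add_le_add_left hp _))
      rw [← EReal.coe_add]
      push_cast
      rfl

end

/-! ### The right regular module and the choice of base ring. -/

/-- The regular right module, as a left module over the opposite ring. -/
def opRegularEquiv (Λ : Type u) [Ring Λ] : Λᵐᵒᵖ ≃ₗ[Λᵐᵒᵖ] Λ where
  toFun := MulOpposite.unop
  invFun := MulOpposite.op
  map_add' _ _ := rfl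
  map_smul' _ _ := rfl
  left_inv _ := rfl
  right_inv _ := rfl

/-- An artin algebra is finite over an artinian commutative ring in its own universe. -/
theorem exists_artinian_base (k : Type*) (R : Type u) [CommRing k] [IsArtinianRing k] [Ring R]
    [Algebra k R] [Module.Finite k R] :
    ∃ (Z : Type u) (_ : CommRing Z) (_ : Algebra Z R), IsArtinianRing Z ∧ Module.Finite Z R := by
  -- The centre is a `k`-submodule of `R`, hence finite over `k` and artinian, and it lives in the
  -- universe of `R`.
  let Z := Subalgebra.center k R
  have hZ : Module.Finite k Z := Module.Finite.of_injective Z.val.toLinearMap Subtype.val_injective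
  have hZa : IsArtinianRing Z := IsArtinianRing.of_finite k Z
  let alg : Algebra Z R := RingHom.toAlgebra' Z.val.toRingHom fun c x =>
    (Subalgebra.mem_center_iff.1 c.2 x).symm
  have : IsScalarTower k Z R := IsScalarTower.of_algebraMap_eq fun x => rfl
  exact ⟨Z, inferInstance, alg, hZa, Module.Finite.of_restrictScalars_finite k Z R⟩

end ExtDimension

open ExtDimension in
theorem theorem3p12 {k : Type*} {Λ : Type u} [CommRing k] [IsArtinianRing k] [Ring Λ] [Algebra k Λ]
    [Module.Finite k Λ] [Nontrivial Λ]
    (V : Set (ModuleCat.{u} Λᵐᵒᵖ)) (hV : ∀ S ∈ V, IsSimpleModule Λᵐᵒᵖ S)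
    (X : ModuleCat.{u} Λᵐᵒᵖ → Prop) (hX : IsSubcategory X) (hfin : IsOfFiniteType X) :
    (IsResolving X →
      extDim Λᵐᵒᵖ ≤ relPdClass X V
        + radicalLayerLength (torsionRadical V) (ModuleCat.of Λᵐᵒᵖ Λ)) ∧
    (IsCoresolving X →
      extDim Λᵐᵒᵖ ≤ relIdClass X V
        + radicalLayerLength (torsionRadical V) (ModuleCat.of Λᵐᵒᵖ Λ)) := by
  obtain ⟨Z, _, _, _, _⟩ := exists_artinian_base k Λᵐᵒᵖ
  have : IsArtinianRing Λᵐᵒᵖ := IsArtinianRing.of_finite Z Λᵐᵒᵖ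
  have hH : HomFinite Λᵐᵒᵖ := homFinite Z
  obtain ⟨J, hJ⟩ := exists_isInjectiveCogenerator Z (R := Λᵐᵒᵖ)
  refine ⟨fun hr => ?_, fun hr => ?_⟩
  · refine extDim_le_add (G := ModuleCat.of Λᵐᵒᵖ Λ) (opRegularEquiv Λ)
      (fun h => by rw [relPdClass, if_pos h]) fun hne => ?_
    refine (relPdClass_eq hV hne).imp_right ?_
    rintro ⟨p, hp, h⟩
    exact ⟨p, hp, fun i hi =>
      extDim_le_of_isResolving hH hJ hV hX hfin hr (opRegularEquiv Λ) hi h⟩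
  · refine extDim_le_add (G := ModuleCat.of Λᵐᵒᵖ Λ) (opRegularEquiv Λ)
      (fun h => by rw [relIdClass, if_pos h]) fun hne => ?_
    refine (relIdClass_eq hV hne).imp_right ?_
    rintro ⟨p, hp, h⟩
    exact ⟨p, hp, fun i hi => extDim_le_of_isCoresolving hH hJ.enoughFiniteInjectives hV hX hfin hr
      (opRegularEquiv Λ) hi h⟩
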